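/- **Theorem (Weakly differentiable functions by partitions).** Let $1 \le m \le n$ be integers, $U \subset \mathbf R^n$ open, $V$ an $m$-dimensional varifold in $U$ (a Radon measure over $U \times \mathbf G(n,m)$, where $\mathbf G(n,m)$ is the space of $m$-dimensional subspaces $P$ of $\mathbf R^n$, with orthogonal projections $P_\natural$), and $Y$ a finite dimensional normed space. Let $\|V\|$ be the weight measure of $V$, let $(\delta V)(\theta) = \int P_\natural \bullet \mathrm D\theta(x) \, \mathrm dV(x,P)$ for $\theta \in \mathscr D(U,\mathbf R^n)$ be its first variation, and suppose that the total variation measure $\|\delta V\|$ is a Radon measure; $\delta V$ is extended by continuity to $\mathbf L_1(\|\delta V\|,\mathbf R^n)$. For a $\|V\|+\|\delta V\|$ measurable set $E$ put $V\,\partial E = (\delta V) \llcorner E - \delta(V \llcorner E \times \mathbf G(n,m))$. A $Y$ valued $\|V\|+\|\delta V\|$ measurable function $f$ defined on a subset of $U$ (hence almost everywhere) belongs to $\mathbf T(V,Y)$ if and only if there is a $\|V\|$ measurable $\operatorname{Hom}(\mathbf R^n,Y)$ valued function $G$ such that $\int_{K \cap \{x : |f(x)| \le s\}} \|G\| \,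 \mathrm d\|V\| < \infty$ for all compact $K \subset U$ and $0 \le s < \infty$, and $$(\delta V)((\gamma\circ f)\theta) = \int \gamma(f(x)) \, P_\natural \bullet \mathrm D\theta(x) + \langle \theta(x), \mathrm D\gamma(f(x)) \circ G(x) \rangle \, \mathrm dV(x,P)$$ for all $\theta \in \mathscr D(U,\mathbf R^n)$ and all smooth $\gamma : Y \to \mathbf R$ such that $\operatorname{spt} \mathrm D\gamma$ is compact. Such $G$ is $\|V\|$ almost unique, and $V\,\mathbf Df$ is the function whose value at $a$ is the $\|V\|$ approximate limit of $G$ at $a$ with respect to closed balls $\mathbf B(a,r) \subset U$, defined wherever this limit exists. Suppose $\Xi$ is a countable set of $m$-dimensional varifolds in $U$, and $\xi$ maps $\Xi$ into the Borel subsets of $U$ such that distinct members of $\Xi$ are mapped onto disjoint sets, $(\|V\|+\|\delta V\|)(U \setminus \bigcup_{W\in\Xi}\xi(W)) = 0$, and $$W = V \llcorner \xi(W) \times \mathbf G(n,m) \quad\text{and}\quad V\,\partial\xi(W) = 0 \qquad \text{for } W \in \Xi.$$ Suppose $f_W \in \mathbf T(W,Y)$ for $W \in \Xi$, and let (as unions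 of graphs) $$f = \bigcup\{ f_W|\xi(W) : W\in\Xi\}, \qquad F = \bigcup\{ (W\,\mathbf Df_W)|\xi(W) : W \in \Xi\}.$$ Then the following three statements hold. 1. The function $f$ is $\|V\|+\|\delta V\|$ measurable. 2. The function $F$ is $\|V\|$ measurable. 3. If $\int_{K\cap\{x : |f(x)|\le s\}} \|F\| \, \mathrm d\|V\| < \infty$ whenever $K$ is a compact subset of $U$ and $0\le s<\infty$, then $f \in \mathbf T(V,Y)$ and $V\,\mathbf Df(x) = F(x)$ for $\|V\|$ almost all $x$. -/

import Mathlib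

open Set Filter Topology MeasureTheory TopologicalSpace
open scoped ENNReal Distributions

noncomputable section

namespace GMT

/-- Euclidean space `ℝⁿ`. -/
abbrev Euc (n : ℕ) : Type := EuclideanSpace ℝ (Fin n)

/-! ### The Grassmann manifold `G(n,m)` -/

/-- `G(n,m)`: the set of all `m`-dimensional linear subspaces of `ℝⁿ`. -/
def Grass (n m : ℕ) : Type :=
  {P : Submodule ℝ (Euc n) // Module.finrank ℝ P = m}

/-- The orthogonal projection `P_♮` of `ℝⁿ` onto `P`, as an endomorphism of `ℝⁿ`. -/
def Grass.proj {n m : ℕ} (P : Grass n m) : Euc n →L[ℝ] Euc n :=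
  P.1.starProjection

/-- `G(n,m)` carries the topology induced by `P ↦ P_♮`. -/
instance {n m : ℕ} : TopologicalSpace (Grass n m) :=
  TopologicalSpace.induced Grass.proj inferInstance

instance {n m : ℕ} : MeasurableSpace (Grass n m) := borel _

instance {n m : ℕ} : BorelSpace (Grass n m) := ⟨rfl⟩

theorem Grass.isInducing_proj {n m : ℕ} :
    IsInducing (Grass.proj : Grass n m → (Euc n →L[ℝ] Euc n)) := ⟨rfl⟩

theorem Grass.continuous_proj {n m : ℕ} :
    Continuous (Grass.proj : Grass n m → (Euc n →L[ℝ] Euc n)) :=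
  Grass.isInducing_proj.continuous

instance {n m : ℕ} : SecondCountableTopology (Grass n m) :=
  Grass.isInducing_proj.secondCountableTopology

theorem Grass.injective_proj {n m : ℕ} :
    Function.Injective (Grass.proj : Grass n m → (Euc n →L[ℝ] Euc n)) := fun _ _ h =>
  Subtype.ext (Submodule.starProjection_inj.mp h)

instance {n m : ℕ} : T2Space (Grass n m) :=
  T2Space.of_injective_continuous Grass.injective_proj Grass.continuous_proj

theorem Grass.range_proj {n m : ℕ} :
    range (Grass.proj : Grass n m → (Euc n →L[ℝ] Euc n)) =
      {T | T.adjoint = T ∧ T * T = T ∧ LinearMap.trace ℝ (Euc n) T.toLinearMap = m} := by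
  ext T
  constructor
  · rintro ⟨P, rfl⟩
    refine ⟨?_, ?_, ?_⟩
    · exact isSelfAdjoint_starProjection P.1
    · exact P.1.isIdempotentElem_starProjection
    · have h : LinearMap.IsProj P.1 P.1.starProjection.toLinearMap :=
        ⟨fun x => by simp, fun x hx => Submodule.starProjection_eq_self_iff.mpr hx⟩
      have := h.trace
      rw [P.2] at this
      exact this
  · rintro ⟨h1, h2, h3⟩
    have hT : IsStarProjection T := ⟨h2, h1⟩
    have hs := ContinuousLinearMap.isStarProjection_iff_isSymmetricProjection.mp hT
    obtain ⟨P, hP, hPT⟩ := LinearMap.isSymmetricProjection_iff_eq_coe_starProjection.mp hs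
    have hTP : T = P.starProjection := by
      ext1 x
      exact LinearMap.congr_fun hPT x
    have h : LinearMap.IsProj P P.starProjection.toLinearMap :=
      ⟨fun x => by simp, fun x hx => Submodule.starProjection_eq_self_iff.mpr hx⟩
    refine ⟨⟨P, ?_⟩, hTP.symm⟩
    have h4 := h.trace
    rw [hTP] at h3
    rw [h3] at h4
    exact_mod_cast h4.symm

instance {n m : ℕ} : CompactSpace (Grass n m) := by
  rw [← isCompact_univ_iff, Grass.isInducing_proj.isCompact_iff, image_univ]
  refine Metric.isCompact_of_isClosed_isBounded ?_ ?_
  · rw [Grass.range_proj]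
    refine IsClosed.inter (isClosed_eq ?_ continuous_id) (IsClosed.inter ?_ ?_)
    · exact ContinuousLinearMap.adjoint.continuous
    · exact isClosed_eq (continuous_id.mul continuous_id) continuous_id
    · refine isClosed_eq ?_ continuous_const
      exact LinearMap.continuous_of_finiteDimensional
        ((LinearMap.trace ℝ (Euc n)).comp (ContinuousLinearMap.coeLM ℝ))
  · refine (Metric.isBounded_closedBall (x := 0) (r := 1)).subset ?_
    rintro _ ⟨P, rfl⟩
    rw [mem_closedBall_zero_iff]
    exact P.1.starProjection_norm_le

/-! ### Varifolds -/

/-- `m`-dimensional varifolds in the open set `U ⊆ ℝⁿ`: Radon measures over `U × G(n,m)`. -/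
@[ext]
structure Varifold {n : ℕ} (m : ℕ) (U : Opens (Euc n)) where
  /-- the underlying measure over `U × G(n,m)` -/
  meas : Measure (U × Grass n m)
  finite_compact : IsFiniteMeasureOnCompacts meas

namespace Varifold

variable {n m : ℕ} {U : Opens (Euc n)}

instance (V : Varifold m U) : IsFiniteMeasureOnCompacts V.meas := V.finite_compact

/-- The weight measure `‖V‖` over `U`. -/
def weight (V : Varifold m U) : Measure U := V.meas.map Prod.fst

/-- The restriction `V ⌞ A × G(n,m)`, used for Borel sets `A`. -/
def restrict (V : Varifold m U) (A : Set U) : Varifold m U where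
  meas := V.meas.restrict (A ×ˢ univ)
  finite_compact := ⟨fun _ hK =>
    (Measure.restrict_apply_le _ _).trans_lt hK.measure_lt_top⟩

/-- The integrand `P_♮ • Dθ(x)` of the first variation; the inner product of two endomorphisms
`A`, `B` of `ℝⁿ` is `trace (A* ∘ B)`, and `P_♮` is self-adjoint. -/
def divIntegrand (θ : Euc n → Euc n) (p : U × Grass n m) : ℝ :=
  LinearMap.trace ℝ (Euc n) (p.2.proj ∘L fderiv ℝ θ p.1).toLinearMap

theorem continuous_divIntegrand (θ : 𝓓(U, Euc n)) :
    Continuous (divIntegrand (n := n) (m := m) (U := U) θ) := by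
  have h1 : Continuous fun A : Euc n →L[ℝ] Euc n => LinearMap.trace ℝ (Euc n) A.toLinearMap :=
    LinearMap.continuous_of_finiteDimensional
      ((LinearMap.trace ℝ (Euc n)).comp (ContinuousLinearMap.coeLM ℝ))
  have h2 : Continuous (fderiv ℝ θ) := θ.contDiff.continuous_fderiv (by simp)
  refine h1.comp (Continuous.clm_comp (Grass.continuous_proj.comp continuous_snd) ?_)
  exact h2.comp (continuous_subtype_val.comp continuous_fst)

theorem integrable_divIntegrand (V : Varifold m U) (θ : 𝓓(U, Euc n)) :
    Integrable (divIntegrand θ) V.meas := by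
  refine (continuous_divIntegrand θ).integrable_of_hasCompactSupport ?_
  have hK : IsCompact ((↑) ⁻¹' tsupport θ : Set U) := by
    have himg : ((↑) '' ((↑) ⁻¹' tsupport θ : Set U) : Set (Euc n)) = tsupport θ :=
      image_preimage_eq_of_subset (by rw [Subtype.range_coe]; exact θ.tsupport_subset)
    rw [Subtype.isCompact_iff, himg]
    exact θ.hasCompactSupport
  refine HasCompactSupport.of_support_subset_isCompact (hK.prod isCompact_univ) ?_
  intro p hp
  refine ⟨?_, mem_univ _⟩
  by_contra h
  apply hp
  have h0 : fderiv ℝ θ (p.1 : Euc n) = 0 := by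
    by_contra h'
    exact h (tsupport_fderiv_subset ℝ (subset_tsupport _ h'))
  simp [divIntegrand, h0]

/-- The first variation `δV(θ) = ∫ P_♮ • Dθ(x) dV(x,P)` for `θ ∈ 𝓓(U,ℝⁿ)`. -/
def firstVariation (V : Varifold m U) : 𝓓(U, Euc n) →ₗ[ℝ] ℝ where
  toFun θ := ∫ p, divIntegrand θ p ∂V.meas
  map_add' θ η := by
    rw [← integral_add (V.integrable_divIntegrand θ) (V.integrable_divIntegrand η)]
    refine integral_congr_ae (ae_of_all _ fun p => ?_)
    have hθ : DifferentiableAt ℝ θ (p.1 : Euc n) := θ.contDiff.differentiable (by simp) _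
    have hη : DifferentiableAt ℝ η (p.1 : Euc n) := η.contDiff.differentiable (by simp) _
    have : fderiv ℝ (θ + η : 𝓓(U, Euc n)) (p.1 : Euc n)
        = fderiv ℝ θ (p.1 : Euc n) + fderiv ℝ η (p.1 : Euc n) := fderiv_add hθ hη
    simp only [divIntegrand]
    rw [this, ContinuousLinearMap.comp_add]
    exact map_add (LinearMap.trace ℝ (Euc n)) _ _
  map_smul' c θ := by
    rw [RingHom.id_apply, smul_eq_mul, ← integral_const_mul]
    refine integral_congr_ae (ae_of_all _ fun p => ?_)
    have hθ : DifferentiableAt ℝ θ (p.1 : Euc n) := θ.contDiff.differentiable (by simp) _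
    have : fderiv ℝ (c • θ : 𝓓(U, Euc n)) (p.1 : Euc n) = c • fderiv ℝ θ (p.1 : Euc n) :=
      fderiv_const_smul hθ c
    simp only [divIntegrand]
    rw [this, ContinuousLinearMap.comp_smul]
    exact map_smul (LinearMap.trace ℝ (Euc n)) c _

end Varifold

/-! ### The variation measure of a linear functional on test fields -/

section Variation

variable {n : ℕ} {U : Opens (Euc n)}

/-- `sup {T(θ) : θ ∈ 𝓓(U,ℝⁿ), spt θ ⊆ A, |θ| ≤ 1}` for open `A ⊆ U`. -/
def variationOpen (T : 𝓓(U, Euc n) →ₗ[ℝ] ℝ) (A : Set U) : ℝ≥0∞ :=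
  ⨆ (θ : 𝓓(U, Euc n)) (_ : tsupport θ ⊆ (↑) '' A) (_ : ∀ x, ‖θ x‖ ≤ 1),
    ENNReal.ofReal (T θ)

theorem variationOpen_empty (T : 𝓓(U, Euc n) →ₗ[ℝ] ℝ) : variationOpen T ∅ = 0 := by
  simp only [variationOpen, ENNReal.iSup_eq_zero]
  intro θ h _
  have : θ = 0 := by
    ext1 x
    rw [image_empty, subset_empty_iff, tsupport_eq_empty_iff] at h
    simp [h]
  simp [this]

theorem variationOpen_mono (T : 𝓓(U, Euc n) →ₗ[ℝ] ℝ) {A B : Set U} (h : A ⊆ B) :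
    variationOpen T A ≤ variationOpen T B :=
  iSup_mono fun _ => iSup_mono' fun hθ => ⟨hθ.trans (image_mono h), le_rfl⟩

theorem variationOpen_add_le (T : 𝓓(U, Euc n) →ₗ[ℝ] ℝ) {A B C : Set U} (h : Disjoint A B)
    (hA : A ⊆ C) (hB : B ⊆ C) :
    variationOpen T A + variationOpen T B ≤ variationOpen T C := by
  have hz : ∀ D : Set U, ∃ θ : 𝓓(U, Euc n), tsupport θ ⊆ (↑) '' D ∧ ∀ x, ‖θ x‖ ≤ 1 :=
    fun D => ⟨0, by simp, by simp⟩
  have hv : ∀ D : Set U, variationOpen T D =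
      ⨆ (θ : 𝓓(U, Euc n)) (_ : tsupport θ ⊆ (↑) '' D ∧ ∀ x, ‖θ x‖ ≤ 1),
        ENNReal.ofReal (T θ) := fun D => by simp only [variationOpen, iSup_and]
  rw [hv A, hv B]
  refine ENNReal.biSup_add_biSup_le' (hz A) (hz B) ?_
  rintro θ ⟨hθ, hθ1⟩ η ⟨hη, hη1⟩
  have hdis : ∀ x, θ x = 0 ∨ η x = 0 := by
    intro x
    by_contra! hx
    obtain ⟨a, ha, rfl⟩ := hθ (subset_tsupport _ hx.1)
    obtain ⟨b, hb, hab⟩ := hη (subset_tsupport _ hx.2)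
    rw [Subtype.ext hab] at hb
    exact h.le_bot ⟨ha, hb⟩
  have hsupp : ∀ ζ : 𝓓(U, Euc n), (∀ x, ζ x ≠ 0 → θ x ≠ 0 ∨ η x ≠ 0) →
      tsupport ζ ⊆ (↑) '' C := by
    intro ζ hζ
    refine (closure_minimal (fun x hx => ?_) ((isClosed_tsupport θ).union (isClosed_tsupport η))).trans
      (union_subset (hθ.trans (image_mono hA)) (hη.trans (image_mono hB)))
    exact (hζ x hx).imp (fun h => subset_tsupport _ h) (fun h => subset_tsupport _ h)
  have key : ∀ ζ : 𝓓(U, Euc n), (∀ x, ζ x ≠ 0 → θ x ≠ 0 ∨ η x ≠ 0) → (∀ x, ‖ζ x‖ ≤ 1) →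
      ENNReal.ofReal (T ζ) ≤ variationOpen T C := fun ζ h1 h2 => by
    rw [hv C]
    exact le_iSup₂_of_le ζ ⟨hsupp ζ h1, h2⟩ le_rfl
  rcases le_total (T θ) 0 with h0 | h0
  · rw [ENNReal.ofReal_of_nonpos h0, zero_add]
    exact key η (fun x hx => Or.inr hx) hη1
  rcases le_total (T η) 0 with h0' | h0'
  · rw [ENNReal.ofReal_of_nonpos h0', add_zero]
    exact key θ (fun x hx => Or.inl hx) hθ1
  rw [← ENNReal.ofReal_add h0 h0', ← map_add]
  refine key (θ + η) (fun x hx => ?_) (fun x => ?_)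
  · by_contra! h'
    exact hx (by simp [h'.1, h'.2])
  · rcases hdis x with hx | hx
    · simpa [hx] using hη1 x
    · simpa [hx] using hθ1 x

/-- The outer measure `‖T‖`: the largest one not exceeding `variationOpen T` on open sets.  On
open sets it equals `variationOpen T`, since the latter is countably subadditive (smooth
partitions of unity). -/
def variationOuter (T : 𝓓(U, Euc n) →ₗ[ℝ] ℝ) : OuterMeasure U :=
  inducedOuterMeasure (fun A (_ : IsOpen A) => variationOpen T A) isOpen_empty
    (variationOpen_empty T)

theorem variationOuter_isMetric (T : 𝓓(U, Euc n) →ₗ[ℝ] ℝ) : (variationOuter T).IsMetric := by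
  rintro s t ⟨r, hr, hst⟩
  refine le_antisymm (measure_union_le s t) ?_
  have hr2 : (0 : ℝ≥0∞) < r / 2 := ENNReal.half_pos hr
  set S : Set U := ⋃ x ∈ s, Metric.eball x (r / 2) with hS
  set R : Set U := ⋃ x ∈ t, Metric.eball x (r / 2) with hR
  have hSo : IsOpen S := isOpen_biUnion fun _ _ => Metric.isOpen_eball
  have hRo : IsOpen R := isOpen_biUnion fun _ _ => Metric.isOpen_eball
  have hsS : s ⊆ S := fun x hx => mem_biUnion hx (Metric.mem_eball_self hr2)
  have htR : t ⊆ R := fun x hx => mem_biUnion hx (Metric.mem_eball_self hr2)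
  have hSR : Disjoint S R := by
    rw [Set.disjoint_left]
    intro z hzS hzR
    obtain ⟨x, hx, hzx⟩ := mem_iUnion₂.mp hzS
    obtain ⟨y, hy, hzy⟩ := mem_iUnion₂.mp hzR
    have h1 : edist x y < r / 2 + r / 2 :=
      (edist_triangle_left x y z).trans_lt (ENNReal.add_lt_add hzx hzy)
    rw [ENNReal.add_halves] at h1
    exact absurd (hst x hx y hy) (not_le.mpr h1)
  have hbound : ∀ (A : Set U) (D : ℕ → Set U), A ⊆ ⋃ i, D i → (∀ i, IsOpen (D i)) →
      variationOuter T A ≤ ∑' i, variationOpen T (D i) := by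
    intro A D hAD hD
    refine (measure_mono hAD).trans ((measure_iUnion_le D).trans ?_)
    refine ENNReal.tsum_le_tsum fun i => ?_
    have h := OuterMeasure.ofFunction_le
      (m_empty := (extend_eq (fun A (_ : IsOpen A) => variationOpen T A) isOpen_empty).trans
        (variationOpen_empty T)) (D i)
    exact h.trans_eq (extend_eq (fun A (_ : IsOpen A) => variationOpen T A) (hD i))
  change _ ≤ inducedOuterMeasure _ _ _ _
  rw [inducedOuterMeasure, OuterMeasure.ofFunction_apply]
  refine le_iInf₂ fun D hD => ?_
  by_cases hop : ∀ i, IsOpen (D i)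
  · have h1 := hbound s (fun i => D i ∩ S)
      (fun x hx => by
        obtain ⟨i, hi⟩ := mem_iUnion.mp (hD (Or.inl hx))
        exact mem_iUnion.mpr ⟨i, hi, hsS hx⟩) (fun i => (hop i).inter hSo)
    have h2 := hbound t (fun i => D i ∩ R)
      (fun x hx => by
        obtain ⟨i, hi⟩ := mem_iUnion.mp (hD (Or.inr hx))
        exact mem_iUnion.mpr ⟨i, hi, htR hx⟩) (fun i => (hop i).inter hRo)
    refine (add_le_add h1 h2).trans ?_
    rw [← ENNReal.tsum_add]
    refine ENNReal.tsum_le_tsum fun i => ?_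
    rw [extend_eq _ (hop i)]
    exact variationOpen_add_le T (hSR.mono inter_subset_right inter_subset_right)
      inter_subset_left inter_subset_left
  · obtain ⟨i, hi⟩ := not_forall.mp hop
    have : extend (fun A (_ : IsOpen A) => variationOpen T A) (D i) = ∞ := by
      simp [extend, hi]
    rw [ENNReal.tsum_eq_top_of_eq_top ⟨i, this⟩]
    exact le_top

/-- The measure `‖T‖` over `U`. -/
def variation (T : 𝓓(U, Euc n) →ₗ[ℝ] ℝ) : Measure U :=
  (variationOuter T).toMeasure
    ((BorelSpace.measurable_eq (α := U)).le.trans (variationOuter_isMetric T).borel_le_caratheodory)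

end Variation
section L1Extension

variable {n : ℕ} {U : Opens (Euc n)}

/-- The value at `g ∈ L₁(‖T‖,ℝⁿ)` of the `‖T‖₍₁₎`-continuous extension of `T`: the limit of
`T(θ)` as `θ ∈ 𝓓(U,ℝⁿ)` approaches `g` in the seminorm `‖T‖₍₁₎`. -/
def extendL1 (T : 𝓓(U, Euc n) →ₗ[ℝ] ℝ) (g : U → Euc n) : ℝ :=
  limUnder (comap (fun θ : 𝓓(U, Euc n) => ∫⁻ x : U, ‖g x - θ x‖ₑ ∂(variation T)) (𝓝 0)) T

end L1Extension

namespace Varifold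

variable {n m : ℕ} {U : Opens (Euc n)}

/-- The measure `‖δV‖` over `U`. -/
def normFirstVariation (V : Varifold m U) : Measure U := variation V.firstVariation

/-- The distributional boundary
`V ∂E = (δV) ⌞ E - δ(V ⌞ E × G(n,m))`, as a functional on `𝓓(U,ℝⁿ)`. -/
def distBoundary (V : Varifold m U) (E : Set U) (θ : 𝓓(U, Euc n)) : ℝ :=
  extendL1 V.firstVariation (E.indicator fun x => θ x) - (V.restrict E).firstVariation θ

end Varifold

/-! ### Measurable partial functions -/

section PartialFunctions

/-- A function `f` with domain contained in `X` is `φ` measurable: it is defined `φ` almost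
everywhere and preimages of open sets are `φ` measurable. -/
structure MeasurablePFun {X Z : Type*} [MeasurableSpace X] [TopologicalSpace Z]
    (φ : Measure X) (f : X →. Z) : Prop where
  ae_dom : φ f.Domᶜ = 0
  preimage_open : ∀ O : Set Z, IsOpen O → NullMeasurableSet (f.preimage O) φ

open Classical in
/-- Extension of a partial function by `0`; only used inside integrals with respect to measures
for which the complement of the domain is a null set. -/
def extendZero {X Z : Type*} [Zero Z] (f : X →. Z) (x : X) : Z :=
  if h : x ∈ f.Dom then f.fn x h else 0

/-- Approximate limit `(φ,C) ap lim_{x → a} F(x) = σ` with respect to the covering relation `C`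
of all closed balls `B(a,r)` contained in `U`: the point `a` belongs to the support of `φ`, and
the sets `{x | F(x) ∉ N}` (with points outside the domain of `F` included) have `φ` density
zero at `a`, for every neighbourhood `N` of `σ`. -/
def HasApproxLimit {n : ℕ} {U : Opens (Euc n)} {Z : Type*} [TopologicalSpace Z]
    (φ : Measure U) (F : U →. Z) (a : U) (σ : Z) : Prop :=
  (∀ r > 0, φ (Metric.closedBall a r) ≠ 0) ∧
  ∀ N ∈ 𝓝 σ, Tendsto
    (fun r : ℝ => φ (Metric.closedBall a r \ F.preimage N) / φ (Metric.closedBall a r))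
    (𝓝[>] 0) (𝓝 0)

end PartialFunctions

/-! ### Generalised weakly differentiable functions -/

namespace Varifold

variable {n m : ℕ} {U : Opens (Euc n)}
  {Y : Type*} [NormedAddCommGroup Y] [NormedSpace ℝ Y]

/-- Local summability of `‖F‖` on the sets where `|f| ≤ s`: for all compact `K ⊆ U` and
`0 ≤ s < ∞`, one has `∫_{K ∩ {x : |f(x)| ≤ s}} ‖F‖ d‖V‖ < ∞`. -/
def TruncSummable (V : Varifold m U) (f : U →. Y) (F : U →. (Euc n →L[ℝ] Y)) : Prop :=
  ∀ K : Set U, IsCompact K → ∀ s : ℝ, 0 ≤ s →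
    ∫⁻ x in K ∩ f.preimage {y | ‖y‖ ≤ s}, ‖extendZero F x‖ₑ ∂V.weight < ∞

/-- `F` is a `‖V‖` measurable function satisfying the two conditions in the definition of
generalised `V` weak differentiability of `f`. -/
structure IsWeakDeriv (V : Varifold m U) (f : U →. Y) (F : U →. (Euc n →L[ℝ] Y)) : Prop where
  measurable : MeasurablePFun V.weight F
  summable : V.TruncSummable f F
  integral_eq : ∀ (θ : 𝓓(U, Euc n)) (γ : Y → ℝ), ContDiff ℝ (⊤ : ℕ∞) γ →
    HasCompactSupport (fderiv ℝ γ) →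
    extendL1 V.firstVariation (fun x => γ (extendZero f x) • θ x) =
      ∫ p : U × Grass n m, (γ (extendZero f p.1) * divIntegrand θ p +
        fderiv ℝ γ (extendZero f p.1) (extendZero F p.1 (θ p.1))) ∂V.meas

/-- `f ∈ T(V,Y)`: the function `f` is generalised `V` weakly differentiable (for varifolds `V`
such that `‖δV‖` is a Radon measure). -/
structure GenWeaklyDiff (V : Varifold m U) (f : U →. Y) : Prop where
  measurable : MeasurablePFun (V.weight + V.normFirstVariation) f
  exists_deriv : ∃ F : U →. (Euc n →L[ℝ] Y), V.IsWeakDeriv f F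

/-- The generalised `V` weak derivative `V D f`: its value at `a` is the approximate limit at `a`
of any `F` as in the definition of generalised `V` weak differentiability (such `F` is unique up
to `‖V‖` null sets); it is defined at `a` if and only if this limit exists. -/
def weakDeriv (V : Varifold m U) (f : U →. Y) : U →. (Euc n →L[ℝ] Y) := fun a =>
  ⟨∃ σ, ∃ F, V.IsWeakDeriv f F ∧ HasApproxLimit V.weight F a σ, fun h => h.choose⟩

end Varifold

end GMT

end

open GMT

/-! The condition `V ∂ξ(W) = 0` says that cutting `V` along `ξ W` creates no boundary: `δW(θ)` is
the value of the extended `δV` at the field `θ` cut off by the indicator of `ξ W`. It follows that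
`‖δW‖` is `‖δV‖` restricted to `ξ W` and that the extension of `δW` to integrable fields is the
extension of `δV` precomposed with that cut-off (`restrict_le_variation`,
`extendL1_eq_extendL1_indicator`). Hence sets and functions measurable for `W` on `ξ W` are
measurable for `V` there, which settles the two measurability claims.

For the third, the defining identity of `f_W` with respect to `W` becomes the identity for `f` with
both sides cut off to `ξ W`. Summing over the countable partition gives the identity for `V`: the
left sides add up because the extension of `δV` is dominated by the `L₁(‖δV‖)` seminorm
(`hasSum_extendL1_indicator`), and the right sides because the full integrand is `V` integrable,
which is where the summability assumption on `F` enters.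

Two general facts support this. First, `|T θ| ≤ ∫ |θ| d‖T‖`, so the extension exists and is a
contraction; this rests on smooth partitions of unity and Lebesgue sums. Second, weak derivatives
are almost unique and almost everywhere equal to their approximate limits, so `V D f` may be
replaced by any representative. -/

noncomputable section

namespace GMT

/-! ### The variation measure on open sets. -/

section Variation

variable {n : ℕ} {U : Opens (Euc n)}

/-- The product of a smooth function and a test field. -/
def smoothSMul (χ : Euc n → ℝ) (hχ : ContDiff ℝ (⊤ : ℕ∞) χ) (θ : 𝓓(U, Euc n)) :
    𝓓(U, Euc n) where
  toFun x := χ x • θ x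
  contDiff' := by
    have h : ContDiff ℝ (⊤ : ℕ∞) (fun x => θ x) := θ.contDiff
    exact ContDiff.smul (𝕜 := ℝ) hχ h
  hasCompactSupport' := θ.hasCompactSupport.mono fun x hx h => hx (by simp [h])
  tsupport_subset' := by
    have h : tsupport (fun x => χ x • θ x) ⊆ tsupport θ :=
      closure_mono fun x hx h => hx (by simp [h])
    exact h.trans θ.tsupport_subset

@[simp]
theorem smoothSMul_apply (χ : Euc n → ℝ) (hχ : ContDiff ℝ (⊤ : ℕ∞) χ) (θ : 𝓓(U, Euc n))
    (x : Euc n) : smoothSMul χ hχ θ x = χ x • θ x := rfl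

theorem isCompact_preimage_tsupport (θ : 𝓓(U, Euc n)) :
    IsCompact ((↑) ⁻¹' tsupport θ : Set U) := by
  have himg : ((↑) '' ((↑) ⁻¹' tsupport θ : Set U) : Set (Euc n)) = tsupport θ :=
    image_preimage_eq_of_subset (by rw [Subtype.range_coe]; exact θ.tsupport_subset)
  rw [Subtype.isCompact_iff, himg]
  exact θ.hasCompactSupport

theorem ofReal_le_mul_variationOpen (T : 𝓓(U, Euc n) →ₗ[ℝ] ℝ) (θ : 𝓓(U, Euc n)) {A : Set U}
    (hA : tsupport θ ⊆ (↑) '' A) {a : ℝ} (ha : ∀ x, ‖θ x‖ ≤ a) :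
    ENNReal.ofReal (T θ) ≤ ENNReal.ofReal a * variationOpen T A := by
  rcases le_or_gt a 0 with h0 | h0
  · have : θ = 0 := by
      ext1 x
      simpa using norm_le_zero_iff.mp ((ha x).trans h0)
    simp [this]
  have h : ENNReal.ofReal (T (a⁻¹ • θ)) ≤ variationOpen T A := by
    refine le_iSup₂_of_le (a⁻¹ • θ) ((closure_mono fun x hx => ?_).trans hA)
      (le_iSup_of_le (fun x => ?_) le_rfl)
    · intro h'
      exact hx (by simp [h'])
    · have : (a⁻¹ • θ) x = a⁻¹ • θ x := rfl
      rw [this, norm_smul, norm_inv, Real.norm_of_nonneg h0.le, inv_mul_le_iff₀ h0, mul_one]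
      exact ha x
  calc ENNReal.ofReal (T θ) = ENNReal.ofReal a * ENNReal.ofReal (T (a⁻¹ • θ)) := by
        rw [← ENNReal.ofReal_mul h0.le, map_smul, smul_eq_mul, mul_inv_cancel_left₀ h0.ne']
    _ ≤ _ := by gcongr

theorem ofReal_sum_le {ι : Type*} (s : Finset ι) (a : ι → ℝ) :
    ENNReal.ofReal (∑ i ∈ s, a i) ≤ ∑ i ∈ s, ENNReal.ofReal (a i) := by
  classical
  induction s using Finset.induction_on with
  | empty => simp
  | insert i s hi ih =>
    rw [Finset.sum_insert hi, Finset.sum_insert hi]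
    exact ENNReal.ofReal_add_le.trans (by gcongr)

/-- Split `θ` by a smooth partition of unity subordinate to the `D i`; the piece on `D i` is bounded
by `a i`. With all `a i = 1` this yields subadditivity of `variationOpen`; with `a i` the heights of
level bands it yields the bound by an integral. -/
theorem ofReal_le_sum_mul_variationOpen (T : 𝓓(U, Euc n) →ₗ[ℝ] ℝ) (θ : 𝓓(U, Euc n))
    {ι : Type} [Fintype ι] (D : ι → Set U) (hD : ∀ i, IsOpen (D i)) (a : ι → ℝ)
    (ha : ∀ i, 0 ≤ a i)
    (hcov : (↑) ⁻¹' tsupport θ ⊆ ⋃ i, D i) (hle : ∀ i, ∀ x ∈ D i, ‖θ x‖ ≤ a i) :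
    ENNReal.ofReal (T θ) ≤ ∑ i, ENNReal.ofReal (a i) * variationOpen T (D i) := by
  obtain ⟨χ, hχ⟩ := SmoothPartitionOfUnity.exists_isSubordinate (modelWithCornersSelf ℝ (Euc n))
    (isClosed_tsupport θ) (fun i => ((↑) '' D i : Set (Euc n)))
    (fun i => U.isOpen.isOpenMap_subtype_val _ (hD i)) (fun x hx => by
      obtain ⟨i, hi⟩ := mem_iUnion.mp (hcov (show (⟨x, θ.tsupport_subset hx⟩ : U) ∈ _ from hx))
      exact mem_iUnion.mpr ⟨i, _, hi, rfl⟩)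
  have hs : ∀ i, ContDiff ℝ (⊤ : ℕ∞) (χ i) := fun i => (χ i).contMDiff.contDiff
  have hsum : θ = ∑ i, smoothSMul (χ i) (hs i) θ := by
    ext1 x
    have : (∑ i, smoothSMul (χ i) (hs i) θ) x = ∑ i, χ i x • θ x := by
      have h := map_sum (⟨⟨fun η : 𝓓(U, Euc n) => η x, rfl⟩, fun _ _ => rfl⟩ :
        𝓓(U, Euc n) →+ Euc n) (fun i => smoothSMul (χ i) (hs i) θ) Finset.univ
      exact h
    rw [this, ← Finset.sum_smul]
    by_cases hx : x ∈ tsupport θ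
    · rw [← finsum_eq_sum_of_fintype, χ.sum_eq_one hx, one_smul]
    · rw [image_eq_zero_of_notMem_tsupport hx, smul_zero]
  calc ENNReal.ofReal (T θ) = ENNReal.ofReal (∑ i, T (smoothSMul (χ i) (hs i) θ)) := by
        conv_lhs => rw [hsum, map_sum]
    _ ≤ ∑ i, ENNReal.ofReal (T (smoothSMul (χ i) (hs i) θ)) := ofReal_sum_le _ _
    _ ≤ _ := by
      refine Finset.sum_le_sum fun i _ => ofReal_le_mul_variationOpen T _
        ((tsupport_smul_subset_left (χ i) θ).trans (hχ i)) fun x => ?_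
      rw [smoothSMul_apply]
      by_cases hx : χ i x = 0
      · simpa [hx] using ha i
      · obtain ⟨y, hy, rfl⟩ := hχ i (subset_tsupport _ hx)
        rw [norm_smul, Real.norm_of_nonneg (χ.nonneg i _)]
        calc χ i y * ‖θ y‖ ≤ 1 * a i := by
              gcongr
              · exact χ.le_one i _
              · exact hle i y hy
          _ = a i := one_mul _

theorem variation_apply (T : 𝓓(U, Euc n) →ₗ[ℝ] ℝ) {s : Set U} (hs : MeasurableSet s) :
    variation T s = variationOuter T s := toMeasure_apply _ _ hs

theorem variationOuter_le_variationOpen (T : 𝓓(U, Euc n) →ₗ[ℝ] ℝ) {A : Set U} (hA : IsOpen A) :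
    variationOuter T A ≤ variationOpen T A :=
  (OuterMeasure.ofFunction_le
      (m_empty := (extend_eq (fun A (_ : IsOpen A) => variationOpen T A) isOpen_empty).trans
        (variationOpen_empty T)) A).trans_eq
    (extend_eq (fun A (_ : IsOpen A) => variationOpen T A) hA)

/-- Only open covers matter, since a non-open member is charged `∞`. -/
theorem le_variationOuter (T : 𝓓(U, Euc n) →ₗ[ℝ] ℝ) {s : Set U} {c : ℝ≥0∞}
    (h : ∀ D : ℕ → Set U, (∀ i, IsOpen (D i)) → s ⊆ ⋃ i, D i → c ≤ ∑' i, variationOpen T (D i)) :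
    c ≤ variationOuter T s := by
  rw [variationOuter, inducedOuterMeasure, OuterMeasure.ofFunction_apply]
  refine le_iInf₂ fun D hD => ?_
  by_cases hop : ∀ i, IsOpen (D i)
  · refine (h D hop hD).trans (ENNReal.tsum_le_tsum fun i => ?_)
    rw [extend_eq _ (hop i)]
  · obtain ⟨i, hi⟩ := not_forall.mp hop
    have : extend (fun A (_ : IsOpen A) => variationOpen T A) (D i) = ∞ := by
      simp [extend, hi]
    rw [ENNReal.tsum_eq_top_of_eq_top ⟨i, this⟩]
    exact le_top

theorem variation_le_variationOpen (T : 𝓓(U, Euc n) →ₗ[ℝ] ℝ) {A : Set U} (hA : IsOpen A) :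
    variation T A ≤ variationOpen T A := by
  rw [variation_apply T hA.measurableSet]
  exact variationOuter_le_variationOpen T hA

theorem variation_of_isOpen (T : 𝓓(U, Euc n) →ₗ[ℝ] ℝ) {A : Set U} (hA : IsOpen A) :
    variation T A = variationOpen T A := by
  refine (variation_le_variationOpen T hA).antisymm ?_
  rw [variation_apply T hA.measurableSet]
  refine le_variationOuter T fun D hD hAD => ?_
  refine iSup₂_le fun θ hθ => iSup_le fun h1 => ?_
  have hcov : (↑) ⁻¹' tsupport θ ⊆ ⋃ i, D i := fun x hx => by
    obtain ⟨y, hy, hxy⟩ := hθ hx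
    rw [← Subtype.ext hxy]
    exact hAD hy
  -- Compactness of the support reduces countable to finite subadditivity.
  obtain ⟨t, ht⟩ := (isCompact_preimage_tsupport θ).elim_finite_subcover D hD hcov
  have := ofReal_le_sum_mul_variationOpen T θ (fun i : t => D i) (fun i => hD i) (fun _ => 1)
    (fun _ => zero_le_one) (by simpa [iUnion_subtype] using ht) (fun i x _ => h1 x)
  simp only [ENNReal.ofReal_one, one_mul] at this
  rw [Finset.sum_coe_sort t fun i => variationOpen T (D i)] at this
  exact this.trans (ENNReal.sum_le_tsum t)

theorem ofReal_le_sum_mul_variation (T : 𝓓(U, Euc n) →ₗ[ℝ] ℝ) (θ : 𝓓(U, Euc n))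
    {ι : Type} [Fintype ι] (D : ι → Set U) (hD : ∀ i, IsOpen (D i)) (a : ι → ℝ)
    (ha : ∀ i, 0 ≤ a i)
    (hcov : (↑) ⁻¹' tsupport θ ⊆ ⋃ i, D i) (hle : ∀ i, ∀ x ∈ D i, ‖θ x‖ ≤ a i) :
    ENNReal.ofReal (T θ) ≤ ∑ i, ENNReal.ofReal (a i) * variation T (D i) := by
  simp only [variation_of_isOpen T (hD _)]
  exact ofReal_le_sum_mul_variationOpen T θ D hD a ha hcov hle

end Variation

/-! ### Domination by the variation integral, and density of test fields. -/

section L1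

variable {n : ℕ} {U : Opens (Euc n)}

instance : LocallyCompactSpace U := U.isOpen.locallyCompactSpace

theorem continuous_comp_val (θ : 𝓓(U, Euc n)) : Continuous fun x : U => θ x :=
  θ.continuous.comp continuous_subtype_val

theorem hasCompactSupport_comp_val (θ : 𝓓(U, Euc n)) : HasCompactSupport fun x : U => θ x :=
  HasCompactSupport.of_support_subset_isCompact (isCompact_preimage_tsupport θ)
    fun _ hx => subset_tsupport _ hx

theorem integrable_comp_val (μ : Measure U) [IsFiniteMeasureOnCompacts μ] (θ : 𝓓(U, Euc n)) :
    Integrable (fun x : U => θ x) μ :=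
  (continuous_comp_val θ).integrable_of_hasCompactSupport (hasCompactSupport_comp_val θ)

/-- A Lebesgue sum: slice `A` by the height of `‖θ‖` into bands of width `η`. In the error, `η * μ
A` comes from rounding heights up, and the further `η` from enlarging the bands to open sets. -/
theorem ofReal_le_lintegral_add (T : 𝓓(U, Euc n) →ₗ[ℝ] ℝ)
    [IsFiniteMeasureOnCompacts (variation T)] (θ : 𝓓(U, Euc n)) {A : Set U} (hA : IsOpen A)
    (hKA : (↑) ⁻¹' tsupport θ ⊆ A) (hμA : variation T A < ∞) {η : ℝ} (hη : 0 < η) :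
    ENNReal.ofReal (T θ) ≤
      ∫⁻ x : U, ‖θ x‖ₑ ∂(variation T) + ENNReal.ofReal η * (variation T A + 1) := by
  set μ := variation T
  have hc : Continuous fun x : U => ‖θ x‖ := (continuous_comp_val θ).norm
  obtain ⟨M, hM⟩ : ∃ M, ∀ x : Euc n, ‖θ x‖ ≤ M :=
    θ.continuous.bounded_above_of_compact_support θ.hasCompactSupport
  obtain ⟨N, hN⟩ := exists_nat_gt (M / η)
  -- Band `i` is `i * η ≤ ‖θ‖ < (i + 1) * η` and `a i` is its upper end; `N > M / η` makes the bands
  -- exhaust `A`.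
  set a : Fin N → ℝ := fun i => ((i : ℕ) + 1) * η with ha
  set E : Fin N → Set U := fun i => A ∩ {x : U | ⌊‖θ x‖ / η⌋₊ = (i : ℕ)} with hE
  have hEm : ∀ i, MeasurableSet (E i) := fun i => hA.measurableSet.inter
    ((Nat.measurable_floor.comp (hc.measurable.div_const η)) (measurableSet_singleton _))
  have hEa : ∀ i, ∀ x ∈ E i, ‖θ x‖ < a i := by
    intro i x hx
    have h := Nat.lt_floor_add_one (‖θ x‖ / η)
    rw [hx.2, div_lt_iff₀ hη] at h
    exact h
  have hEl : ∀ i, ∀ x ∈ E i, a i ≤ ‖θ x‖ + η := by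
    intro i x hx
    have h := Nat.floor_le (a := ‖θ x‖ / η) (by positivity)
    rw [hx.2, le_div_iff₀ hη] at h
    simp only [ha]
    linarith
  have hEd : Pairwise (Function.onFun Disjoint E) := by
    intro i j hij
    refine Set.disjoint_left.mpr fun x hx hx' => hij (Fin.ext ?_)
    exact hx.2.symm.trans hx'.2
  have ha0 : ∀ i, 0 ≤ a i := fun i => by positivity
  set C : ℝ≥0∞ := ∑ i, ENNReal.ofReal (a i) with hC
  have hCt : C ≠ ∞ := by simp [hC]
  -- The measure excess allowed per band, so small that the weighted total `C * δ` is at most `η`.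
  set δ : ℝ≥0∞ := ENNReal.ofReal η / (C + 1) with hδ
  have hδ0 : δ ≠ 0 := by
    simp only [hδ, ne_eq, ENNReal.div_eq_zero_iff, not_or]
    exact ⟨by simpa using hη, by simp [hCt]⟩
  have hCδ : C * δ ≤ ENNReal.ofReal η :=
    calc C * δ ≤ (C + 1) * δ := by gcongr; exact le_self_add
      _ ≤ _ := ENNReal.mul_div_le
  choose O hEO hO hOlt using fun i => (E i).exists_isOpen_lt_add (μ := μ)
    ((measure_mono inter_subset_left).trans_lt hμA).ne hδ0
  -- Intersecting with `‖θ‖ < a i` restores the height bound that may fail on `O i`, and keeps the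
  -- sets open.
  have key := ofReal_le_sum_mul_variation T θ (fun i => O i ∩ {x : U | ‖θ x‖ < a i})
    (fun i => (hO i).inter (isOpen_lt hc continuous_const)) a ha0 (fun x hx => by
      have hlt : ⌊‖θ x‖ / η⌋₊ < N := by
        rw [Nat.floor_lt (by positivity)]
        exact lt_of_le_of_lt (by gcongr; exact hM x) hN
      have hxE : x ∈ E ⟨_, hlt⟩ := ⟨hKA hx, rfl⟩
      exact mem_iUnion.mpr ⟨⟨_, hlt⟩, hEO _ hxE, hEa _ x hxE⟩) (fun i x hx => hx.2.le)
  refine key.trans ?_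
  calc ∑ i, ENNReal.ofReal (a i) * μ (O i ∩ {x : U | ‖θ x‖ < a i})
      ≤ ∑ i, (ENNReal.ofReal (a i) * μ (E i) + ENNReal.ofReal (a i) * δ) := by
        refine Finset.sum_le_sum fun i _ => ?_
        rw [← mul_add]
        gcongr
        exact (measure_mono inter_subset_left).trans (hOlt i).le
    _ = ∑ i, ENNReal.ofReal (a i) * μ (E i) + C * δ := by
        rw [Finset.sum_add_distrib, Finset.sum_mul]
    _ ≤ ∑ i, ∫⁻ x in E i, (‖θ x‖ₑ + ENNReal.ofReal η) ∂μ + ENNReal.ofReal η := by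
        gcongr with i
        rw [← setLIntegral_const]
        refine setLIntegral_mono' (hEm i) fun x hx => ?_
        rw [← ofReal_norm, ← ENNReal.ofReal_add (norm_nonneg _) hη.le]
        exact ENNReal.ofReal_le_ofReal (hEl i x hx)
    _ = ∫⁻ x in ⋃ i, E i, (‖θ x‖ₑ + ENNReal.ofReal η) ∂μ + ENNReal.ofReal η := by
        rw [lintegral_iUnion hEm hEd, tsum_fintype]
    _ ≤ ∫⁻ x in A, (‖θ x‖ₑ + ENNReal.ofReal η) ∂μ + ENNReal.ofReal η := by
        gcongr
        exact iUnion_subset fun i => inter_subset_left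
    _ = ∫⁻ x in A, ‖θ x‖ₑ ∂μ + ENNReal.ofReal η * (μ A + 1) := by
        rw [lintegral_add_right _ measurable_const, setLIntegral_const, mul_add, mul_one, add_assoc]
    _ ≤ _ := by
        gcongr
        exact Measure.restrict_le_self

theorem ofReal_le_lintegral (T : 𝓓(U, Euc n) →ₗ[ℝ] ℝ)
    [IsFiniteMeasureOnCompacts (variation T)] (θ : 𝓓(U, Euc n)) :
    ENNReal.ofReal (T θ) ≤ ∫⁻ x : U, ‖θ x‖ₑ ∂(variation T) := by
  obtain ⟨A, hKA, hA, hμA⟩ := (isCompact_preimage_tsupport θ).exists_open_superset_measure_lt_top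
    (variation T)
  have hb : Tendsto (fun η : ℝ => ∫⁻ x : U, ‖θ x‖ₑ ∂(variation T) +
      ENNReal.ofReal η * (variation T A + 1)) (𝓝[>] 0)
      (𝓝 (∫⁻ x : U, ‖θ x‖ₑ ∂(variation T) + ENNReal.ofReal 0 * (variation T A + 1))) := by
    refine Tendsto.mono_left ?_ nhdsWithin_le_nhds
    refine tendsto_const_nhds.add (ENNReal.Tendsto.mul_const ?_ (Or.inr ?_))
    · exact ENNReal.tendsto_ofReal tendsto_id
    · simp [hμA.ne]
  rw [ENNReal.ofReal_zero, zero_mul, add_zero] at hb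
  refine ge_of_tendsto hb ?_
  filter_upwards [self_mem_nhdsWithin] with η hη
  exact ofReal_le_lintegral_add T θ hA hKA hμA hη

theorem enorm_le_lintegral (T : 𝓓(U, Euc n) →ₗ[ℝ] ℝ)
    [IsFiniteMeasureOnCompacts (variation T)] (θ : 𝓓(U, Euc n)) :
    ‖T θ‖ₑ ≤ ∫⁻ x : U, ‖θ x‖ₑ ∂(variation T) := by
  rw [Real.enorm_eq_ofReal_abs]
  rcases abs_choice (T θ) with h | h <;> rw [h]
  · exact ofReal_le_lintegral T θ
  · have h := ofReal_le_lintegral T (-θ)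
    rw [map_neg] at h
    refine h.trans_eq (lintegral_congr fun x => ?_)
    have : (-θ) (x : Euc n) = -θ x := rfl
    rw [this, enorm_neg]

/-- Test fields are dense in the space of integrable functions. -/
theorem exists_lintegral_sub_le (μ : Measure U) [IsFiniteMeasureOnCompacts μ] {g : U → Euc n}
    (hg : Integrable g μ) {ε : ℝ≥0∞} (hε : ε ≠ 0) :
    ∃ θ : 𝓓(U, Euc n), ∫⁻ x : U, ‖g x - θ x‖ₑ ∂μ ≤ ε := by
  obtain ⟨h, hsupp, hle, hcont, -⟩ :=
    hg.exists_hasCompactSupport_lintegral_sub_le (ENNReal.half_pos hε).ne'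
  set H : Euc n → Euc n := Function.extend Subtype.val h 0 with hH
  have hHh : ∀ x : U, H x = h x := fun x => Subtype.val_injective.extend_apply _ _ _
  have hHc : Continuous H := hsupp.continuous_extend_zero U.isOpen hcont
  have hK : IsCompact ((↑) '' tsupport h : Set (Euc n)) :=
    hsupp.isCompact.image continuous_subtype_val
  have hHK : tsupport H ⊆ (↑) '' tsupport h := by
    refine closure_minimal (fun x hx => ?_) hK.isClosed
    by_cases hxU : x ∈ U
    · exact ⟨⟨x, hxU⟩, subset_tsupport _ (by rwa [Function.mem_support, ← hHh ⟨x, hxU⟩]), rfl⟩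
    · exact absurd (Function.extend_apply' _ _ _ (by simpa using hxU)) hx
  obtain ⟨δ, hδ, hδε⟩ : ∃ δ : ℝ, 0 < δ ∧ ENNReal.ofReal δ * μ (tsupport h) ≤ ε / 2 := by
    have hb : Tendsto (fun η : ℝ => ENNReal.ofReal η * μ (tsupport h)) (𝓝[>] 0)
        (𝓝 (ENNReal.ofReal 0 * μ (tsupport h))) := by
      refine Tendsto.mono_left ?_ nhdsWithin_le_nhds
      exact ENNReal.Tendsto.mul_const (ENNReal.tendsto_ofReal tendsto_id)
        (Or.inr hsupp.isCompact.measure_lt_top.ne)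
    rw [ENNReal.ofReal_zero, zero_mul] at hb
    obtain ⟨δ, h1, h2⟩ :=
      ((hb.eventually (gt_mem_nhds (ENNReal.half_pos hε))).and self_mem_nhdsWithin).exists
    exact ⟨δ, h2, h1.le⟩
  -- The support of `k` lies in that of `H`, so `k` is a test field and the uniform error `δ` is
  -- integrated over `tsupport h` only.
  obtain ⟨k, hk, hkH, hks⟩ := hHc.exists_contDiff_approx ⊤ continuous_const (fun _ => hδ)
  have hkt : tsupport k ⊆ (↑) '' tsupport h := (closure_mono hks).trans hHK
  refine ⟨⟨k, hk, HasCompactSupport.of_support_subset_isCompact hK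
    ((subset_tsupport k).trans hkt), hkt.trans (image_subset_iff.mpr fun x _ => x.2)⟩, ?_⟩
  calc ∫⁻ x : U, ‖g x - k x‖ₑ ∂μ ≤ ∫⁻ x : U, (‖g x - h x‖ₑ + ‖h x - k x‖ₑ) ∂μ := by
        refine lintegral_mono fun x => ?_
        rw [← sub_add_sub_cancel (g x) (h x) (k x)]
        exact enorm_add_le _ _
    _ = ∫⁻ x : U, ‖g x - h x‖ₑ ∂μ + ∫⁻ x : U, ‖h x - k x‖ₑ ∂μ := by
        refine lintegral_add_right _ ?_
        exact (hcont.sub (hk.continuous.comp continuous_subtype_val)).enorm.measurable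
    _ ≤ ε / 2 + ε / 2 := by
        gcongr
        refine le_trans ?_ hδε
        rw [← setLIntegral_const, ← lintegral_indicator (isClosed_tsupport h).measurableSet]
        refine lintegral_mono fun x => ?_
        by_cases hx : x ∈ tsupport h
        · rw [indicator_of_mem hx, ← ofReal_norm, ← hHh x, ← dist_eq_norm, dist_comm]
          exact ENNReal.ofReal_le_ofReal (hkH x).le
        · have h1 : h x = 0 := image_eq_zero_of_notMem_tsupport hx
          have h2 : k x = 0 := by
            by_contra h'
            obtain ⟨y, hy, hyx⟩ := hkt (subset_tsupport k h')
            exact hx (Subtype.ext hyx ▸ hy)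
          simp [h1, h2]
    _ = ε := ENNReal.add_halves ε

end L1

/-! ### The extension of `T` to integrable fields. -/

section Extension

variable {n : ℕ} {U : Opens (Euc n)} (T : 𝓓(U, Euc n) →ₗ[ℝ] ℝ)

theorem lintegral_sub_comm (μ : Measure U) (g h : U → Euc n) :
    ∫⁻ x, ‖g x - h x‖ₑ ∂μ = ∫⁻ x, ‖h x - g x‖ₑ ∂μ :=
  lintegral_congr fun x => by rw [← enorm_neg, neg_sub]

theorem lintegral_sub_le_add {μ : Measure U} {f g h : U → Euc n}
    (hg : AEStronglyMeasurable g μ) (hf : AEStronglyMeasurable f μ) :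
    ∫⁻ x, ‖f x - h x‖ₑ ∂μ ≤ ∫⁻ x, ‖f x - g x‖ₑ ∂μ + ∫⁻ x, ‖g x - h x‖ₑ ∂μ := by
  refine le_trans (lintegral_mono fun x => ?_) (lintegral_add_left' (hf.sub hg).enorm _).le
  change ‖f x - h x‖ₑ ≤ ‖f x - g x‖ₑ + ‖g x - h x‖ₑ
  rw [← sub_add_sub_cancel (f x) (g x) (h x)]
  exact enorm_add_le _ _

variable [IsFiniteMeasureOnCompacts (variation T)]

theorem enorm_sub_le_lintegral_sub (θ η : 𝓓(U, Euc n)) :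
    ‖T θ - T η‖ₑ ≤ ∫⁻ x : U, ‖θ x - η x‖ₑ ∂(variation T) := by
  rw [← map_sub]
  exact enorm_le_lintegral T (θ - η)

theorem enorm_sub_le_add {g : U → Euc n} (hg : AEStronglyMeasurable g (variation T))
    (θ η : 𝓓(U, Euc n)) :
    ‖T θ - T η‖ₑ ≤ ∫⁻ x : U, ‖g x - θ x‖ₑ ∂(variation T) +
      ∫⁻ x : U, ‖g x - η x‖ₑ ∂(variation T) := by
  refine (enorm_sub_le_lintegral_sub T θ η).trans ?_
  rw [lintegral_sub_comm _ g fun x => θ x]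
  exact lintegral_sub_le_add hg (integrable_comp_val (variation T) θ).aestronglyMeasurable

/-- Density of test fields makes the filter in `extendL1` nontrivial; the limit there then exists
because `T` maps this filter to a Cauchy filter. -/
theorem neBot_comap {g : U → Euc n} (hg : Integrable g (variation T)) :
    (comap (fun θ : 𝓓(U, Euc n) => ∫⁻ x : U, ‖g x - θ x‖ₑ ∂(variation T)) (𝓝 0)).NeBot := by
  rw [ENNReal.nhds_zero_basis_Iic.comap _ |>.neBot_iff]
  intro ε hε
  exact exists_lintegral_sub_le (variation T) hg hε.ne'

theorem tendsto_extendL1 {g : U → Euc n} (hg : Integrable g (variation T)) :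
    Tendsto T (comap (fun θ : 𝓓(U, Euc n) => ∫⁻ x : U, ‖g x - θ x‖ₑ ∂(variation T)) (𝓝 0))
      (𝓝 (extendL1 T g)) := by
  have hne := neBot_comap T hg
  refine tendsto_nhds_limUnder ?_
  refine cauchy_map_iff_exists_tendsto.mp (EMetric.cauchy_iff.mpr ⟨(hne.map _).ne, fun ε hε => ?_⟩)
  have hε2 : (0 : ℝ≥0∞) < ε / 2 := ENNReal.half_pos hε.ne'
  refine ⟨_, image_mem_map (preimage_mem_comap (Iio_mem_nhds hε2)), ?_⟩
  rintro _ ⟨θ, hθ, rfl⟩ _ ⟨η, hη, rfl⟩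
  rw [edist_eq_enorm_sub]
  refine (enorm_sub_le_add T hg.aestronglyMeasurable θ η).trans_lt ?_
  exact (ENNReal.add_lt_add hθ hη).trans_eq (ENNReal.add_halves ε)

theorem enorm_sub_extendL1_le {g : U → Euc n} (hg : Integrable g (variation T))
    (θ : 𝓓(U, Euc n)) :
    ‖T θ - extendL1 T g‖ₑ ≤ ∫⁻ x : U, ‖g x - θ x‖ₑ ∂(variation T) := by
  have hne := neBot_comap T hg
  have h1 := ((tendsto_const_nhds (x := T θ)).sub (tendsto_extendL1 T hg)).enorm
  have h2 := (tendsto_const_nhds (x := ∫⁻ x : U, ‖g x - θ x‖ₑ ∂(variation T))).add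
    (tendsto_comap (f := fun θ : 𝓓(U, Euc n) => ∫⁻ x : U, ‖g x - θ x‖ₑ ∂(variation T)) (x := 𝓝 0))
  rw [add_zero] at h2
  exact le_of_tendsto_of_tendsto' h1 h2 fun η => enorm_sub_le_add T hg.aestronglyMeasurable θ η

theorem enorm_extendL1_le {g : U → Euc n} (hg : Integrable g (variation T)) :
    ‖extendL1 T g‖ₑ ≤ ∫⁻ x : U, ‖g x‖ₑ ∂(variation T) := by
  have h := enorm_sub_extendL1_le T hg 0
  rw [map_zero, zero_sub, enorm_neg] at h
  refine h.trans_eq (lintegral_congr fun x => ?_)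
  rw [show (0 : 𝓓(U, Euc n)) (x : Euc n) = 0 from rfl, sub_zero]

/-- The working criterion for computing the extension: one approximating test field for each `ε`
suffices, without handling the filter. -/
theorem extendL1_eq_of_forall_le {g : U → Euc n} (hg : Integrable g (variation T)) {c : ℝ}
    (h : ∀ ε : ℝ≥0∞, ε ≠ 0 → ∃ θ : 𝓓(U, Euc n),
      ∫⁻ x : U, ‖g x - θ x‖ₑ ∂(variation T) ≤ ε ∧ ‖T θ - c‖ₑ ≤ ε) :
    extendL1 T g = c := by
  rw [← sub_eq_zero, ← enorm_eq_zero, ← nonpos_iff_eq_zero]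
  refine le_of_forall_gt_imp_ge_of_dense fun ε hε => ?_
  obtain ⟨θ, h1, h2⟩ := h (ε / 2) (ENNReal.half_pos hε.ne').ne'
  have h3 := enorm_sub_extendL1_le T hg θ
  calc ‖extendL1 T g - c‖ₑ = ‖(T θ - c) - (T θ - extendL1 T g)‖ₑ := by congr 1; ring
    _ ≤ ‖T θ - c‖ₑ + ‖T θ - extendL1 T g‖ₑ := enorm_sub_le
    _ ≤ ε / 2 + ε / 2 := add_le_add h2 (h3.trans h1)
    _ = ε := ENNReal.add_halves ε

theorem extendL1_add {g h : U → Euc n} (hg : Integrable g (variation T))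
    (hh : Integrable h (variation T)) :
    extendL1 T (fun x => g x + h x) = extendL1 T g + extendL1 T h := by
  refine extendL1_eq_of_forall_le T (hg.add hh) fun ε hε => ?_
  have hε2 := (ENNReal.half_pos hε).ne'
  obtain ⟨θ, hθ⟩ := exists_lintegral_sub_le (variation T) hg hε2
  obtain ⟨η, hη⟩ := exists_lintegral_sub_le (variation T) hh hε2
  refine ⟨θ + η, ?_, ?_⟩
  · calc ∫⁻ x : U, ‖g x + h x - (θ + η) x‖ₑ ∂(variation T)
        ≤ ∫⁻ x : U, (‖g x - θ x‖ₑ + ‖h x - η x‖ₑ) ∂(variation T) := by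
          refine lintegral_mono fun x => ?_
          have : g x + h x - (θ + η) x = (g x - θ x) + (h x - η x) :=
            add_sub_add_comm _ _ _ _
          rw [this]
          exact enorm_add_le _ _
      _ = _ := lintegral_add_left'
          (hg.aestronglyMeasurable.sub (integrable_comp_val _ θ).aestronglyMeasurable).enorm _
      _ ≤ ε / 2 + ε / 2 := add_le_add hθ hη
      _ = ε := ENNReal.add_halves ε
  · calc ‖T (θ + η) - (extendL1 T g + extendL1 T h)‖ₑ
        = ‖(T θ - extendL1 T g) + (T η - extendL1 T h)‖ₑ := by
          rw [map_add, add_sub_add_comm]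
      _ ≤ ‖T θ - extendL1 T g‖ₑ + ‖T η - extendL1 T h‖ₑ := enorm_add_le _ _
      _ ≤ ε / 2 + ε / 2 := add_le_add ((enorm_sub_extendL1_le T hg θ).trans hθ)
          ((enorm_sub_extendL1_le T hh η).trans hη)
      _ = ε := ENNReal.add_halves ε

theorem extendL1_sub {g h : U → Euc n} (hg : Integrable g (variation T))
    (hh : Integrable h (variation T)) :
    extendL1 T (fun x => g x - h x) = extendL1 T g - extendL1 T h := by
  have := extendL1_add T (hg.sub hh) hh
  simp only [Pi.sub_apply, sub_add_cancel] at this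
  rw [this]
  exact (add_sub_cancel_right _ _).symm

theorem enorm_extendL1_sub_le {g h : U → Euc n} (hg : Integrable g (variation T))
    (hh : Integrable h (variation T)) :
    ‖extendL1 T g - extendL1 T h‖ₑ ≤ ∫⁻ x : U, ‖g x - h x‖ₑ ∂(variation T) := by
  rw [← extendL1_sub T hg hh]
  exact enorm_extendL1_le T (hg.sub hh)

theorem extendL1_sum_indicator {ι : Type*} {g : U → Euc n} (hg : Integrable g (variation T))
    {A : ι → Set U} (hA : ∀ i, MeasurableSet (A i)) (hd : Pairwise (Function.onFun Disjoint A))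
    (s : Finset ι) :
    ∑ i ∈ s, extendL1 T ((A i).indicator g) = extendL1 T ((⋃ i ∈ s, A i).indicator g) := by
  classical
  induction s using Finset.induction_on with
  | empty =>
    have h : Integrable (fun _ : U => (0 : Euc n)) (variation T) := integrable_zero _ _ _
    have h0 := extendL1_sub T h h
    simp only [sub_self] at h0
    simpa using h0.symm
  | insert i s hi ih =>
    rw [Finset.sum_insert hi, ih, ← extendL1_add T (hg.indicator (hA i))
      (hg.indicator (s.measurableSet_biUnion fun j _ => hA j))]
    congr 1
    rw [Finset.set_biUnion_insert, indicator_union_of_disjoint]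
    rw [disjoint_iUnion₂_right]
    intro j hj
    exact hd (fun h => hi (h ▸ hj))

/-- The remainder after a finite set of pieces is the extension at `g` cut off to the complement of
those pieces, so it is dominated by the remainder of the convergent series for `∫ ‖g‖`. -/
theorem hasSum_extendL1_indicator {ι : Type*} [Countable ι] {g : U → Euc n}
    (hg : Integrable g (variation T))
    {A : ι → Set U} (hA : ∀ i, MeasurableSet (A i)) (hd : Pairwise (Function.onFun Disjoint A))
    (hcov : variation T (⋃ i, A i)ᶜ = 0) :
    HasSum (fun i => extendL1 T ((A i).indicator g)) (extendL1 T g) := by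
  have hcov' : ∀ᵐ x ∂variation T, x ∈ ⋃ i, A i := mem_ae_iff.mpr hcov
  have hN : HasSum (fun i => ∫ x in A i, ‖g x‖ ∂(variation T)) (∫ x, ‖g x‖ ∂(variation T)) := by
    have := hasSum_integral_iUnion hA hd hg.norm.integrableOn
    rwa [Measure.restrict_eq_self_of_ae_mem hcov'] at this
  rw [HasSum, SummationFilter.unconditional_filter] at hN ⊢
  have h0 := (tendsto_const_nhds (x := ∫ x, ‖g x‖ ∂(variation T))).sub hN
  rw [sub_self] at h0
  rw [tendsto_iff_norm_sub_tendsto_zero]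
  refine squeeze_zero (fun _ => norm_nonneg _) (fun s => ?_) h0
  have hm : MeasurableSet (⋃ i ∈ s, A i) := s.measurableSet_biUnion fun j _ => hA j
  have hi : Integrable (((⋃ i ∈ s, A i)ᶜ).indicator g) (variation T) := hg.indicator hm.compl
  have h1 := enorm_extendL1_le T hi
  have h2 : extendL1 T (((⋃ i ∈ s, A i)ᶜ).indicator g) =
      extendL1 T g - ∑ i ∈ s, extendL1 T ((A i).indicator g) := by
    rw [extendL1_sum_indicator T hg hA hd, ← extendL1_sub T hg (hg.indicator hm),
      indicator_compl]
    rfl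
  rw [h2] at h1
  rw [norm_sub_rev]
  have h3 := ENNReal.toReal_mono hi.2.ne h1
  rw [toReal_enorm] at h3
  refine h3.trans_eq ?_
  rw [← integral_norm_eq_lintegral_enorm hi.1]
  have h4 : ∀ x, ‖((⋃ i ∈ s, A i)ᶜ).indicator g x‖ =
      ((⋃ i ∈ s, A i)ᶜ).indicator (fun x => ‖g x‖) x := fun x => norm_indicator_eq_indicator_norm _ _
  simp only [h4]
  rw [integral_indicator hm.compl, setIntegral_compl hm hg.norm,
    integral_biUnion_finset s (fun i _ => hA i) (hd.set_pairwise _)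
      fun i _ => hg.norm.integrableOn]

end Extension

/-! ### Functionals of the form `θ ↦ T(1_E θ)`. -/

section Restriction

variable {n : ℕ} {U : Opens (Euc n)} {T S : 𝓓(U, Euc n) →ₗ[ℝ] ℝ}
  [IsFiniteMeasureOnCompacts (variation T)] {E : Set U}

/-- On open sets this is the contraction bound for `1_E θ`; outer regularity of the restricted
measure passes to Borel sets. -/
theorem variation_le_restrict (hE : MeasurableSet E)
    (hS : ∀ θ : 𝓓(U, Euc n), S θ = extendL1 T (E.indicator fun x => θ x)) :
    variation S ≤ (variation T).restrict E := by
  have hopen : ∀ A : Set U, IsOpen A → variation S A ≤ (variation T).restrict E A := by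
    intro A hA
    refine (variation_le_variationOpen S hA).trans ?_
    refine iSup₂_le fun θ hθ => iSup_le fun h1 => ?_
    rw [hS]
    calc ENNReal.ofReal (extendL1 T (E.indicator fun x => θ x))
        ≤ ‖extendL1 T (E.indicator fun x => θ x)‖ₑ := Real.ofReal_le_enorm _
      _ ≤ ∫⁻ x, ‖E.indicator (fun x : U => θ x) x‖ₑ ∂(variation T) :=
        enorm_extendL1_le T ((integrable_comp_val _ θ).indicator hE)
      _ ≤ ∫⁻ x, (A ∩ E).indicator (fun _ => 1) x ∂(variation T) := by
        refine lintegral_mono fun x => ?_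
        by_cases hx : x ∈ A ∩ E
        · rw [indicator_of_mem hx, indicator_of_mem hx.2, ← ofReal_norm, ← ENNReal.ofReal_one]
          exact ENNReal.ofReal_le_ofReal (h1 x)
        · have : E.indicator (fun x : U => θ x) x = 0 := by
            by_contra h'
            have hxE := mem_of_indicator_ne_zero h'
            rw [indicator_of_mem hxE] at h'
            obtain ⟨y, hy, hyx⟩ := hθ (subset_tsupport _ h')
            exact hx ⟨Subtype.ext hyx ▸ hy, hxE⟩
          simp [this]
      _ = (variation T).restrict E A := by
        rw [lintegral_indicator_const (hA.measurableSet.inter hE), one_mul,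
          Measure.restrict_apply hA.measurableSet]
  refine Measure.le_iff.mpr fun s hs => ?_
  rw [s.measure_eq_iInf_isOpen ((variation T).restrict E)]
  exact le_iInf₂ fun A hsA => le_iInf fun hA => (measure_mono hsA).trans (hopen A hA)

/-- Take `K` compact in `A ∩ E` and `O` open with `K ⊆ O ⊆ A` and `O \ E` of small measure. For `θ`
supported in `O` with `‖θ‖ ≤ 1`, the values `T θ` and `S θ` differ by at most the measure of `O \
E`, so `variation T K` is almost bounded by `variationOpen S A`. -/
theorem measure_inter_le_variationOpen (hE : MeasurableSet E)
    (hS : ∀ θ : 𝓓(U, Euc n), S θ = extendL1 T (E.indicator fun x => θ x))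
    {A : Set U} (hA : IsOpen A) : variation T (A ∩ E) ≤ variationOpen S A := by
  rw [(hA.measurableSet.inter hE).measure_eq_iSup_isCompact]
  refine iSup₂_le fun K hK => iSup_le fun hKc => ?_
  refine ENNReal.le_of_forall_pos_le_add fun ε hε _ => ?_
  obtain ⟨O', hKO', hO', hlt⟩ := K.exists_isOpen_lt_add (μ := variation T)
    hKc.measure_lt_top.ne (ε := ε) (by simpa using hε.ne')
  set O := O' ∩ A with hOdef
  have hO : IsOpen O := hO'.inter hA
  have hKO : K ⊆ O := subset_inter hKO' (hK.trans inter_subset_left)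
  have hdiff : variation T (O \ E) ≤ ε := by
    calc variation T (O \ E) ≤ variation T (O' \ K) :=
          measure_mono (sdiff_subset_sdiff inter_subset_left (hK.trans inter_subset_right))
      _ = variation T O' - variation T K :=
          measure_sdiff hKO' hKc.measurableSet.nullMeasurableSet hKc.measure_lt_top.ne
      _ ≤ ε := by
          rw [tsub_le_iff_left]
          exact hlt.le
  refine (measure_mono hKO).trans ?_
  rw [variation_of_isOpen T hO]
  refine iSup₂_le fun θ hθ => iSup_le fun h1 => ?_
  have hθi := integrable_comp_val (variation T) θ
  calc ENNReal.ofReal (T θ) = ENNReal.ofReal (S θ + (T θ - S θ)) := by rw [add_sub_cancel]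
    _ ≤ ENNReal.ofReal (S θ) + ENNReal.ofReal (T θ - S θ) := ENNReal.ofReal_add_le
    _ ≤ variationOpen S A + ε := by
      gcongr
      · exact le_iSup₂_of_le θ (hθ.trans (image_mono inter_subset_right))
          (le_iSup_of_le h1 le_rfl)
      · refine (Real.ofReal_le_enorm _).trans ?_
        rw [hS]
        refine (enorm_sub_extendL1_le T (hθi.indicator hE) θ).trans (le_trans ?_ hdiff)
        rw [← one_mul (variation T (O \ E)), ← lintegral_indicator_const
          (hO.measurableSet.diff hE)]
        refine lintegral_mono fun x => ?_
        by_cases hxE : x ∈ E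
        · simp [hxE]
        rw [indicator_of_notMem hxE, zero_sub, enorm_neg]
        by_cases hx : x ∈ O
        · rw [indicator_of_mem (show x ∈ O \ E from ⟨hx, hxE⟩), ← ofReal_norm, ← ENNReal.ofReal_one]
          exact ENNReal.ofReal_le_ofReal (h1 x)
        · have : θ x = 0 := by
            by_contra h'
            obtain ⟨y, hy, hyx⟩ := hθ (subset_tsupport _ h')
            exact hx (Subtype.ext hyx ▸ hy)
          simp [this]

theorem restrict_le_variation (hE : MeasurableSet E)
    (hS : ∀ θ : 𝓓(U, Euc n), S θ = extendL1 T (E.indicator fun x => θ x)) :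
    (variation T).restrict E ≤ variation S := by
  refine Measure.le_iff.mpr fun s hs => ?_
  rw [variation_apply S hs]
  refine le_variationOuter S fun D hD hsD => ?_
  calc (variation T).restrict E s ≤ ∑' i, (variation T).restrict E (D i) :=
        (measure_mono hsD).trans (measure_iUnion_le D)
    _ ≤ _ := ENNReal.tsum_le_tsum fun i => by
        rw [Measure.restrict_apply (hD i).measurableSet]
        exact measure_inter_le_variationOpen hE hS (hD i)

theorem extendL1_eq_extendL1_indicator (hE : MeasurableSet E)
    (hS : ∀ θ : 𝓓(U, Euc n), S θ = extendL1 T (E.indicator fun x => θ x)) {g : U → Euc n}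
    (hg : Integrable g ((variation T).restrict E)) :
    extendL1 S g = extendL1 T (E.indicator g) := by
  have hle := variation_le_restrict hE hS
  have : IsFiniteMeasureOnCompacts (variation S) :=
    ⟨fun K hK => (hle K).trans_lt hK.measure_lt_top⟩
  refine extendL1_eq_of_forall_le S (hg.mono_measure hle) fun ε hε => ?_
  -- A test field close to `g` for `‖T‖` restricted to `E` serves both sides, as `variation S` is no
  -- larger.
  obtain ⟨θ, hθ⟩ := exists_lintegral_sub_le _ hg hε
  refine ⟨θ, (lintegral_mono' hle le_rfl).trans hθ, ?_⟩
  rw [hS]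
  refine (enorm_extendL1_sub_le T ((integrable_comp_val _ θ).indicator hE)
    ((integrable_indicator_iff hE).mpr hg)).trans (le_trans ?_ hθ)
  rw [← lintegral_indicator hE, lintegral_sub_comm]
  refine (lintegral_congr fun x => ?_).le
  by_cases hx : x ∈ E <;> simp [hx]

end Restriction

/-! ### The weight measure. -/

namespace Varifold

variable {n m : ℕ} {U : Opens (Euc n)} (V : Varifold m U)

theorem weight_apply {A : Set U} (hA : MeasurableSet A) : V.weight A = V.meas (A ×ˢ univ) := by
  rw [weight, Measure.map_apply measurable_fst hA, prod_univ]

instance : IsFiniteMeasureOnCompacts V.weight := ⟨fun K hK => by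
  rw [V.weight_apply hK.measurableSet]
  exact (hK.prod isCompact_univ).measure_lt_top⟩

theorem weight_restrict {A : Set U} (hA : MeasurableSet A) :
    (V.restrict A).weight = V.weight.restrict A := by
  have h : (V.restrict A).meas = V.meas.restrict (Prod.fst ⁻¹' A) := by
    rw [← prod_univ]
    rfl
  rw [weight, weight, Measure.restrict_map measurable_fst hA, h]

theorem integrable_comp_fst {Z : Type*} [NormedAddCommGroup Z] {g : U → Z}
    (hg : Integrable g V.weight) : Integrable (fun p : U × Grass n m => g p.1) V.meas :=
  hg.comp_measurable measurable_fst

theorem integral_comp_fst {Z : Type*} [NormedAddCommGroup Z] [NormedSpace ℝ Z] {g : U → Z}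
    (hg : AEStronglyMeasurable g V.weight) :
    ∫ p : U × Grass n m, g p.1 ∂V.meas = ∫ x, g x ∂V.weight :=
  (integral_map measurable_fst.aemeasurable hg).symm

theorem ae_comp_fst {p : U → Prop} (h : ∀ᵐ x ∂V.weight, p x) :
    ∀ᵐ q : U × Grass n m ∂V.meas, p q.1 :=
  ae_of_ae_map measurable_fst.aemeasurable h

end Varifold

/-! ### Measurability of partial functions. -/

section PartialFunctions

variable {X Z : Type*} {f g : X →. Z}

theorem extendZero_of_mem [Zero Z] {x : X} {y : Z} (h : y ∈ f x) : extendZero f x = y := by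
  obtain ⟨h1, h2⟩ := h
  rw [extendZero, dif_pos (show x ∈ f.Dom from h1)]
  exact h2

theorem extendZero_mem [Zero Z] {x : X} (h : x ∈ f.Dom) : extendZero f x ∈ f x := by
  rw [extendZero, dif_pos h]
  exact ⟨h, rfl⟩

theorem mem_preimage_iff_extendZero [Zero Z] {x : X} (h : x ∈ f.Dom) (O : Set Z) :
    x ∈ f.preimage O ↔ extendZero f x ∈ O := by
  rw [PFun.mem_preimage]
  constructor
  · rintro ⟨y, hy, hyx⟩
    rwa [extendZero_of_mem hyx]
  · intro h'
    exact ⟨_, h', extendZero_mem h⟩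

variable [MeasurableSpace X] {φ ψ : Measure X} [TopologicalSpace Z]

theorem MeasurablePFun.ae_mem_dom (hf : MeasurablePFun φ f) : ∀ᵐ x ∂φ, x ∈ f.Dom :=
  mem_ae_iff.mpr hf.ae_dom

theorem MeasurablePFun.mono_ac (hf : MeasurablePFun φ f) (h : ψ ≪ φ) : MeasurablePFun ψ f :=
  ⟨h hf.ae_dom, fun O hO => (hf.preimage_open O hO).mono_ac h⟩

theorem MeasurablePFun.aestronglyMeasurable [Zero Z] [SecondCountableTopology Z]
    [PseudoMetrizableSpace Z] (hf : MeasurablePFun φ f) :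
    AEStronglyMeasurable (extendZero f) φ := by
  borelize Z
  refine aestronglyMeasurable_iff_nullMeasurable_separable.mpr
    ⟨?_, univ, isSeparable_univ_iff.mpr inferInstance, by simp⟩
  have h : ∀ O : Set Z, IsOpen O → NullMeasurableSet (extendZero f ⁻¹' O) φ := fun O hO => by
    refine (hf.preimage_open O hO).congr ?_
    filter_upwards [hf.ae_mem_dom] with x hx
    exact propext (mem_preimage_iff_extendZero hx O)
  intro s hs
  induction s, hs using MeasurableSpace.generateFrom_induction with
  | hC t ht => exact h t ht
  | empty => simp
  | compl t _ ih => exact ih.compl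
  | iUnion s _ ih => rw [preimage_iUnion]; exact NullMeasurableSet.iUnion ih

theorem measurablePFun_of_ae_eq [Zero Z] (hf : MeasurablePFun φ f)
    (h : ∀ᵐ x ∂φ, extendZero f x ∈ g x) : MeasurablePFun φ g := by
  refine ⟨?_, fun O hO => (hf.preimage_open O hO).congr ?_⟩
  · suffices ∀ᵐ x ∂φ, x ∈ g.Dom from mem_ae_iff.mp this
    filter_upwards [h] with x hx
    exact (PFun.mem_dom _ _).mpr ⟨_, hx⟩
  · filter_upwards [h, hf.ae_mem_dom] with x hx hd
    refine propext ((mem_preimage_iff_extendZero hd O).trans ?_)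
    rw [← extendZero_of_mem hx]
    exact (mem_preimage_iff_extendZero ((PFun.mem_dom _ _).mpr ⟨_, hx⟩) O).symm

/-- A partial function assembled from countably many pieces is measurable. -/
theorem measurablePFun_of_pieces {ι : Type*} {I : Set ι} (hI : I.Countable) {A : ι → Set X}
    (hA : ∀ i ∈ I, MeasurableSet (A i)) (hcov : φ (⋃ i ∈ I, A i)ᶜ = 0) {p : ι → (X →. Z)}
    (hp : ∀ i ∈ I, MeasurablePFun (φ.restrict (A i)) (p i))
    (hf : ∀ x y, y ∈ f x ↔ ∃ i ∈ I, x ∈ A i ∧ y ∈ p i x) : MeasurablePFun φ f := by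
  constructor
  · have hsub : f.Domᶜ ⊆ (⋃ i ∈ I, A i)ᶜ ∪ ⋃ i ∈ I, ((p i).Domᶜ ∩ A i) := by
      intro x hx
      by_contra h
      rw [mem_union, not_or, mem_compl_iff, not_not] at h
      obtain ⟨i, hi, hxi⟩ := mem_iUnion₂.mp h.1
      have hd : x ∈ (p i).Dom := by
        by_contra h'
        exact h.2 (mem_iUnion₂.mpr ⟨i, hi, h', hxi⟩)
      obtain ⟨y, hy⟩ := (PFun.mem_dom _ _).mp hd
      exact hx ((PFun.mem_dom _ _).mpr ⟨y, (hf x y).mpr ⟨i, hi, hxi, hy⟩⟩)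
    refine measure_mono_null hsub (measure_union_null hcov ?_)
    refine (measure_biUnion_null_iff hI).mpr fun i hi => ?_
    rw [← Measure.restrict_apply' (hA i hi)]
    exact (hp i hi).ae_dom
  · intro O hO
    have heq : f.preimage O = ⋃ i ∈ I, ((p i).preimage O ∩ A i) := by
      ext x
      simp only [PFun.mem_preimage, hf, mem_iUnion, mem_inter_iff]
      constructor
      · rintro ⟨y, hy, i, hi, hx, hyx⟩
        exact ⟨i, hi, ⟨y, hy, hyx⟩, hx⟩
      · rintro ⟨i, hi, ⟨y, hy, hyx⟩, hx⟩
        exact ⟨y, hy, i, hi, hx, hyx⟩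
    rw [heq]
    refine NullMeasurableSet.biUnion hI fun i hi => ?_
    exact (nullMeasurableSet_restrict (hA i hi).nullMeasurableSet).mp
      ((hp i hi).preimage_open O hO)

end PartialFunctions

/-! ### Approximate limits over closed balls. -/

section ApproximateLimits

variable {n : ℕ} {U : Opens (Euc n)}

/-- A satellite configuration in `U` is one in the ambient space, where large ones are excluded.
This gives access to density theorems for measures over `U`. -/
instance : HasBesicovitchCovering U := by
  obtain ⟨N, τ, hτ, hN⟩ := HasBesicovitchCovering.no_satelliteConfig (α := Euc n)
  exact ⟨N, τ, hτ, ⟨fun c => hN.false ⟨fun i => c.c i, c.r, c.rpos, c.h, c.hlast, c.inter⟩⟩⟩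

theorem eventually_measure_closedBall_lt_top (φ : Measure U) [IsFiniteMeasureOnCompacts φ] (a : U) :
    ∀ᶠ r : ℝ in 𝓝[>] 0, φ (Metric.closedBall a r) < ∞ := by
  obtain ⟨s, hs, hφ⟩ := φ.finiteAt_nhds a
  obtain ⟨ε, hε, hsub⟩ := Metric.nhds_basis_closedBall.mem_iff.mp hs
  filter_upwards [Ioc_mem_nhdsGT hε] with r hr
  exact (measure_mono ((Metric.closedBall_subset_closedBall hr.2).trans hsub)).trans_lt hφ

theorem ae_measure_closedBall_ne_zero (φ : Measure U) :
    ∀ᵐ a ∂φ, ∀ r > 0, φ (Metric.closedBall a r) ≠ 0 := by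
  filter_upwards [Measure.support_mem_ae (μ := φ)] with a ha r hr
  exact ((Measure.mem_support_iff_forall a).mp ha _ (Metric.closedBall_mem_nhds a hr)).ne'

variable {φ : Measure U} {Z : Type*} [TopologicalSpace Z] {F G : U →. Z}

/-- Almost every point of `F.preimage N` is a density point of it, simultaneously for all `N` in a
countable basis of the target. -/
theorem ae_hasApproxLimit [IsFiniteMeasureOnCompacts φ] [Zero Z] [SecondCountableTopology Z]
    (hF : MeasurablePFun φ F) :
    ∀ᵐ a ∂φ, HasApproxLimit φ F a (extendZero F a) := by
  have hB := countable_countableBasis Z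
  have h1 : ∀ᵐ a ∂φ, ∀ N ∈ countableBasis Z, a ∈ F.preimage N → Tendsto
      (fun r => φ (F.preimage N ∩ Metric.closedBall a r) / φ (Metric.closedBall a r))
      (𝓝[>] 0) (𝓝 1) := by
    rw [ae_ball_iff hB]
    intro N hN
    rw [← ae_restrict_iff'₀ (hF.preimage_open N (isOpen_of_mem_countableBasis hN))]
    exact Besicovitch.ae_tendsto_measure_inter_div φ _
  filter_upwards [h1, ae_measure_closedBall_ne_zero φ, hF.ae_mem_dom] with a ha h0 hd
  refine ⟨h0, fun N hN => ?_⟩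
  obtain ⟨B, hBm, haB, hBN⟩ := (isBasis_countableBasis Z).mem_nhds_iff.mp hN
  have h2 := ha B hBm ((mem_preimage_iff_extendZero hd B).mpr haB)
  have h3 := ENNReal.Tendsto.sub (tendsto_const_nhds (x := (1 : ℝ≥0∞))) h2
    (Or.inl ENNReal.one_ne_top)
  rw [tsub_self] at h3
  refine tendsto_of_tendsto_of_tendsto_of_le_of_le' tendsto_const_nhds h3
    (Eventually.of_forall fun _ => zero_le) ?_
  filter_upwards [eventually_measure_closedBall_lt_top φ a, self_mem_nhdsWithin] with r hr hr0
  have h4 := measure_inter_add_sdiff₀ (Metric.closedBall a r)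
    (hF.preimage_open B (isOpen_of_mem_countableBasis hBm))
  rw [inter_comm] at h4
  have hne : φ (F.preimage B ∩ Metric.closedBall a r) ≠ ∞ :=
    ((measure_mono inter_subset_right).trans_lt hr).ne
  have h5 := ENNReal.eq_sub_of_add_eq hne (add_comm _ _ |>.trans h4)
  calc φ (Metric.closedBall a r \ F.preimage N) / φ (Metric.closedBall a r)
      ≤ φ (Metric.closedBall a r \ F.preimage B) / φ (Metric.closedBall a r) := by
        gcongr
        exact PFun.preimage_mono F hBN
    _ = _ := by
        rw [h5, ENNReal.sub_div (fun _ _ => h0 r hr0), ENNReal.div_self (h0 r hr0) hr.ne]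

theorem HasApproxLimit.unique [IsFiniteMeasureOnCompacts φ] [T2Space Z] {a : U} {σ τ : Z}
    (h1 : HasApproxLimit φ F a σ)
    (h2 : HasApproxLimit φ F a τ) : σ = τ := by
  by_contra hne
  obtain ⟨A, B, hA, hB, hσ, hτ, hd⟩ := t2_separation hne
  have h3 := (h1.2 A (hA.mem_nhds hσ)).add (h2.2 B (hB.mem_nhds hτ))
  rw [add_zero] at h3
  -- As `A` and `B` are disjoint, each point of the ball lies in one of the two exceptional sets,
  -- yet both have density zero.
  have h4 : ∀ᶠ r : ℝ in 𝓝[>] 0, (1 : ℝ≥0∞) ≤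
      φ (Metric.closedBall a r \ F.preimage A) / φ (Metric.closedBall a r) +
      φ (Metric.closedBall a r \ F.preimage B) / φ (Metric.closedBall a r) := by
    filter_upwards [eventually_measure_closedBall_lt_top φ a, self_mem_nhdsWithin] with r hr hr0
    rw [← ENNReal.add_div, ← ENNReal.div_self (h1.1 r hr0) hr.ne]
    gcongr
    refine (measure_mono fun x hx => ?_).trans (measure_union_le _ _)
    by_contra h
    simp only [mem_union, Set.mem_sdiff, hx, true_and, not_or, not_not] at h
    obtain ⟨⟨y, hy, hyx⟩, ⟨z, hz, hzx⟩⟩ := h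
    exact hd.le_bot ⟨hy, Part.mem_unique hzx hyx ▸ hz⟩
  exact absurd (ge_of_tendsto h3 h4) (by simp)

theorem HasApproxLimit.congr_ae [Zero Z] {a : U} {σ : Z} (h : HasApproxLimit φ F a σ)
    (hF : ∀ᵐ x ∂φ, x ∈ F.Dom) (hG : ∀ᵐ x ∂φ, x ∈ G.Dom)
    (hFG : ∀ᵐ x ∂φ, extendZero F x = extendZero G x) : HasApproxLimit φ G a σ := by
  refine ⟨h.1, fun N hN => (h.2 N hN).congr fun r => ?_⟩
  congr 1
  refine measure_congr ?_
  filter_upwards [hF, hG, hFG] with x h1 h2 h3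
  refine propext (and_congr_right fun _ => not_congr ?_)
  rw [mem_preimage_iff_extendZero h1, mem_preimage_iff_extendZero h2, h3]

end ApproximateLimits

/-! ### Smooth functions whose derivative has compact support. -/

section Gamma

variable {Y : Type*} [NormedAddCommGroup Y] [NormedSpace ℝ Y]

theorem exists_norm_le_of_fderiv_ne_zero {γ : Y → ℝ} (hc : HasCompactSupport (fderiv ℝ γ)) :
    ∃ s : ℝ, 0 < s ∧ ∀ y, fderiv ℝ γ y ≠ 0 → ‖y‖ ≤ s := by
  obtain ⟨s, hs, h⟩ := hc.isCompact.isBounded.exists_pos_norm_le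
  exact ⟨s, hs, fun y hy => h y (subset_tsupport _ hy)⟩

/-- Such `γ` is constant along each ray outside a ball, so a bound on a larger compact ball is a
global bound. -/
theorem exists_forall_norm_le_of_hasCompactSupport_fderiv [FiniteDimensional ℝ Y] {γ : Y → ℝ}
    (hγ : Differentiable ℝ γ) (hc : HasCompactSupport (fderiv ℝ γ)) : ∃ C, ∀ y, ‖γ y‖ ≤ C := by
  obtain ⟨s, hs, h⟩ := exists_norm_le_of_fderiv_ne_zero hc
  have : ProperSpace Y := FiniteDimensional.proper ℝ Y
  obtain ⟨C, hC⟩ := (isCompact_closedBall (0 : Y) (2 * s)).exists_bound_of_continuousOn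
    hγ.continuous.continuousOn
  refine ⟨C, fun y => ?_⟩
  by_cases hy : ‖y‖ ≤ 2 * s
  · exact hC y (by simpa using hy)
  rw [not_le] at hy
  have hy0 : 0 < ‖y‖ := by linarith
  have hle : 2 * s / ‖y‖ ≤ 1 := by rw [div_le_one hy0]; exact hy.le
  -- The segment starts where the ray through `y` meets the sphere of radius `2 * s`, strictly
  -- outside the radius `s` beyond which the derivative vanishes.
  have hconst := constant_of_has_deriv_right_zero (f := fun t : ℝ => γ (t • y))
    (a := 2 * s / ‖y‖) (b := 1) (hγ.continuous.comp (by fun_prop)).continuousOn (fun t ht => by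
      have h0 : fderiv ℝ γ (t • y) = 0 := by
        by_contra h'
        have h1 := h _ h'
        rw [norm_smul] at h1
        have h2 : 2 * s ≤ t * ‖y‖ := (div_le_iff₀ hy0).mp ht.1
        have h3 : t * ‖y‖ ≤ ‖t‖ * ‖y‖ := by gcongr; exact Real.le_norm_self t
        linarith
      have h1 : HasFDerivAt γ (0 : Y →L[ℝ] ℝ) (t • y) := h0 ▸ (hγ (t • y)).hasFDerivAt
      have h2 : HasDerivAt (fun t : ℝ => t • y) y t := by
        simpa using (hasDerivAt_id t).smul_const y
      have := h1.comp_hasDerivAt t h2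
      exact this.hasDerivWithinAt) 1 ⟨hle, le_rfl⟩
  simp only [one_smul] at hconst
  rw [hconst]
  refine hC _ ?_
  rw [mem_closedBall_zero_iff, norm_smul, Real.norm_of_nonneg (by positivity),
    div_mul_cancel₀ _ hy0.ne']

end Gamma

/-! ### Almost uniqueness of weak derivatives. -/

namespace Varifold

variable {n m : ℕ} {U : Opens (Euc n)} {V : Varifold m U}
  {Y : Type*} [NormedAddCommGroup Y] [NormedSpace ℝ Y] [FiniteDimensional ℝ Y]
  {f : U →. Y} {F G : U →. (Euc n →L[ℝ] Y)}

theorem secondCountableTopology_target (Y : Type*) [NormedAddCommGroup Y] [NormedSpace ℝ Y]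
    [FiniteDimensional ℝ Y] : SecondCountableTopology Y :=
  have : ProperSpace Y := FiniteDimensional.proper ℝ Y
  inferInstance

/-- The function `x ↦ Dγ(f(x)) ∘ F(x)`. -/
def chainDeriv (γ : Y → ℝ) (f : U →. Y) (F : U →. (Euc n →L[ℝ] Y)) (x : U) : Euc n →L[ℝ] ℝ :=
  (fderiv ℝ γ (extendZero f x)).comp (extendZero F x)

/-- `Dγ ∘ f` is bounded and vanishes off some `{‖f‖ ≤ s}`, exactly where `F` is locally summable. -/
theorem locallyIntegrable_chainDeriv (hf : MeasurablePFun V.weight f)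
    (hF : MeasurablePFun V.weight F) (hsum : V.TruncSummable f F) {γ : Y → ℝ}
    (hγ : ContDiff ℝ (⊤ : ℕ∞) γ) (hc : HasCompactSupport (fderiv ℝ γ)) :
    LocallyIntegrable (chainDeriv γ f F) V.weight := by
  have hY := secondCountableTopology_target Y
  have hcont : Continuous (fderiv ℝ γ) := hγ.continuous_fderiv (by simp)
  obtain ⟨s, hs, hsb⟩ := exists_norm_le_of_fderiv_ne_zero hc
  obtain ⟨C, hC⟩ := hcont.bounded_above_of_compact_support hc
  have hC0 : 0 ≤ C := (norm_nonneg _).trans (hC 0)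
  have hm : AEStronglyMeasurable (chainDeriv γ f F) V.weight :=
    (ContinuousLinearMap.compL ℝ (Euc n) Y ℝ).aestronglyMeasurable_comp₂
      (hcont.comp_aestronglyMeasurable hf.aestronglyMeasurable) hF.aestronglyMeasurable
  refine locallyIntegrable_iff.mpr fun K hK => ⟨hm.restrict, ?_⟩
  set P : Set U := f.preimage {y | ‖y‖ ≤ s} with hP
  calc ∫⁻ x in K, ‖chainDeriv γ f F x‖ₑ ∂V.weight
      = ∫⁻ x, K.indicator (fun x => ‖chainDeriv γ f F x‖ₑ) x ∂V.weight :=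
        (lintegral_indicator hK.measurableSet _).symm
    _ ≤ ∫⁻ x, (K ∩ P).indicator (fun x => ENNReal.ofReal C * ‖extendZero F x‖ₑ) x ∂V.weight := by
        refine lintegral_mono_ae ?_
        filter_upwards [hf.ae_mem_dom] with x hd
        by_cases hxK : x ∈ K
        swap
        · simp [hxK]
        rw [indicator_of_mem hxK]
        by_cases hxP : x ∈ P
        · rw [indicator_of_mem (show x ∈ K ∩ P from ⟨hxK, hxP⟩), ← ofReal_norm, ← ofReal_norm,
            ← ENNReal.ofReal_mul hC0]
          refine ENNReal.ofReal_le_ofReal ((ContinuousLinearMap.opNorm_comp_le _ _).trans ?_)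
          gcongr
          exact hC _
        · have h0 : fderiv ℝ γ (extendZero f x) = 0 := by
            by_contra h'
            exact hxP ((mem_preimage_iff_extendZero hd _).mpr (hsb _ h'))
          rw [chainDeriv, h0, ContinuousLinearMap.zero_comp, ← ofReal_norm, norm_zero,
            ENNReal.ofReal_zero]
          exact zero_le
    -- This inequality requires no measurability of `P`.
    _ ≤ ∫⁻ x in K ∩ P, ENNReal.ofReal C * ‖extendZero F x‖ₑ ∂V.weight :=
        lintegral_indicator_le _ _
    _ = ENNReal.ofReal C * ∫⁻ x in K ∩ P, ‖extendZero F x‖ₑ ∂V.weight :=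
        lintegral_const_mul' _ _ ENNReal.ofReal_ne_top
    _ < ∞ := ENNReal.mul_lt_top ENNReal.ofReal_lt_top (hsum K hK s hs.le)

theorem integrable_apply_testField {μ : Measure U} [IsFiniteMeasureOnCompacts μ]
    {h : U → (Euc n →L[ℝ] ℝ)} (hh : LocallyIntegrable h μ) (θ : 𝓓(U, Euc n)) :
    Integrable (fun x => h x (θ x)) μ := by
  obtain ⟨M, hM⟩ : ∃ M, ∀ x : Euc n, ‖θ x‖ ≤ M :=
    θ.continuous.bounded_above_of_compact_support θ.hasCompactSupport
  have hK := isCompact_preimage_tsupport θ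
  set K : Set U := (↑) ⁻¹' tsupport θ with hKdef
  have hb : Integrable (K.indicator fun x => ‖h x‖ * M) μ :=
    (integrable_indicator_iff hK.measurableSet).mpr
      ((hh.integrableOn_isCompact hK).norm.mul_const M)
  refine hb.mono' ((ContinuousLinearMap.id ℝ (Euc n →L[ℝ] ℝ)).aestronglyMeasurable_comp₂
    hh.aestronglyMeasurable (continuous_comp_val θ).aestronglyMeasurable) (ae_of_all _ fun x => ?_)
  by_cases hx : x ∈ K
  · rw [indicator_of_mem hx]
    refine ((h x).le_opNorm _).trans ?_
    gcongr
    exact hM x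
  · have : θ x = 0 := image_eq_zero_of_notMem_tsupport hx
    simp [hx, this]

/-- Push `μ` forward to the ambient space, extend `h` by zero, and apply the fundamental lemma of
the calculus of variations; fields `g • v` with `v` fixed test each component. -/
theorem ae_eq_zero_of_integral_testField_eq_zero {μ : Measure U} [IsFiniteMeasureOnCompacts μ]
    {h : U → (Euc n →L[ℝ] ℝ)} (hh : LocallyIntegrable h μ)
    (h0 : ∀ θ : 𝓓(U, Euc n), ∫ x, h x (θ x) ∂μ = 0) : ∀ᵐ x ∂μ, h x = 0 := by
  have hemb : MeasurableEmbedding ((↑) : U → Euc n) :=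
    MeasurableEmbedding.subtype_coe U.isOpen.measurableSet
  set H : Euc n → (Euc n →L[ℝ] ℝ) := Function.extend Subtype.val h 0 with hH
  have hHh : ∀ x : U, H x = h x := fun x => Subtype.val_injective.extend_apply _ _ _
  have hHc : H ∘ ((↑) : U → Euc n) = h := funext hHh
  have hloc : LocallyIntegrableOn H U (μ.map (↑)) := by
    rw [locallyIntegrableOn_iff U.isOpen.isLocallyClosed]
    intro K hKU hK
    rw [hemb.integrableOn_map_iff, hHc]
    refine hh.integrableOn_isCompact ?_
    rw [Subtype.isCompact_iff, image_preimage_eq_of_subset (by rwa [Subtype.range_coe])]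
    exact hK
  have key := U.isOpen.ae_eq_zero_of_integral_contDiff_smul_eq_zero hloc fun g hg hgc hgU => by
    rw [hemb.integral_map]
    simp only [hHh]
    have hgs : HasCompactSupport fun x : U => g x := by
      refine HasCompactSupport.of_support_subset_isCompact (K := (↑) ⁻¹' tsupport g) ?_
        fun x hx => subset_tsupport g hx
      rw [Subtype.isCompact_iff, image_preimage_eq_of_subset (by rwa [Subtype.range_coe])]
      exact hgc
    have hi : Integrable (fun x : U => g x • h x) μ :=
      hh.integrable_smul_left_of_hasCompactSupport
        (hg.continuous.comp continuous_subtype_val) hgs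
    ext v
    rw [ContinuousLinearMap.integral_apply hi]
    have hgv : tsupport (fun x => g x • v) ⊆ tsupport g :=
      closure_mono fun x hx h => hx (by simp [h])
    have := h0 ⟨fun x => g x • v, hg.smul contDiff_const,
      hgc.mono' ((subset_tsupport _).trans hgv), hgv.trans hgU⟩
    rw [zero_apply, ← this]
    refine integral_congr_ae (ae_of_all _ fun x => ?_)
    change (g x • h x) v = h x (g x • v)
    simp
  filter_upwards [ae_of_ae_map hemb.measurable.aemeasurable key] with x hx
  rw [← hHh]
  exact hx x.2

theorem integrable_continuous_comp_mul (hf : MeasurablePFun V.weight f) {γ : Y → ℝ}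
    (hγ : Continuous γ) {C : ℝ} (hC : ∀ y, ‖γ y‖ ≤ C) {h : U × Grass n m → ℝ}
    (hh : Integrable h V.meas) :
    Integrable (fun p => γ (extendZero f p.1) * h p) V.meas := by
  have hY := secondCountableTopology_target Y
  refine hh.bdd_mul (c := C) ?_ (ae_of_all _ fun p => hC _)
  exact (hγ.comp_aestronglyMeasurable hf.aestronglyMeasurable).comp_measurable measurable_fst

theorem integrable_weakDeriv_integrand (hf : MeasurablePFun V.weight f)
    (hF : MeasurablePFun V.weight F) (hsum : V.TruncSummable f F) {γ : Y → ℝ}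
    (hγ : ContDiff ℝ (⊤ : ℕ∞) γ) (hc : HasCompactSupport (fderiv ℝ γ)) (θ : 𝓓(U, Euc n)) :
    Integrable (fun p : U × Grass n m => γ (extendZero f p.1) * divIntegrand θ p +
        fderiv ℝ γ (extendZero f p.1) (extendZero F p.1 (θ p.1))) V.meas := by
  obtain ⟨C, hC⟩ := exists_forall_norm_le_of_hasCompactSupport_fderiv
    (hγ.differentiable (by simp)) hc
  exact (integrable_continuous_comp_mul hf hγ.continuous hC (V.integrable_divIntegrand θ)).add
    (V.integrable_comp_fst
      (integrable_apply_testField (locallyIntegrable_chainDeriv hf hF hsum hγ hc) θ))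

theorem IsWeakDeriv.chainDeriv_ae_eq (hf : MeasurablePFun V.weight f)
    (hF : V.IsWeakDeriv f F) (hG : V.IsWeakDeriv f G) {γ : Y → ℝ}
    (hγ : ContDiff ℝ (⊤ : ℕ∞) γ) (hc : HasCompactSupport (fderiv ℝ γ)) :
    chainDeriv γ f F =ᵐ[V.weight] chainDeriv γ f G := by
  have h1 := locallyIntegrable_chainDeriv hf hF.measurable hF.summable hγ hc
  have h2 := locallyIntegrable_chainDeriv hf hG.measurable hG.summable hγ hc
  have key := ae_eq_zero_of_integral_testField_eq_zero (h1.sub h2) fun θ => by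
    have i1 := integrable_apply_testField h1 θ
    have i2 := integrable_apply_testField h2 θ
    change ∫ x, (chainDeriv γ f F x (θ x) - chainDeriv γ f G x (θ x)) ∂V.weight = 0
    have e1 := hF.integral_eq θ γ hγ hc
    have e2 := hG.integral_eq θ γ hγ hc
    rw [e1, ← sub_eq_zero, ← integral_sub
      (integrable_weakDeriv_integrand hf hF.measurable hF.summable hγ hc θ)
      (integrable_weakDeriv_integrand hf hG.measurable hG.summable hγ hc θ)] at e2
    refine (integral_comp_fst V (i1.sub i2).aestronglyMeasurable).symm.trans ?_
    rw [← e2]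
    refine integral_congr_ae (ae_of_all _ fun p => ?_)
    simp [chainDeriv]
  filter_upwards [key] with x hx
  exact sub_eq_zero.mp hx

/-- Generalised weak derivatives are almost unique. -/
theorem IsWeakDeriv.ae_eq (hf : MeasurablePFun V.weight f)
    (hF : V.IsWeakDeriv f F) (hG : V.IsWeakDeriv f G) :
    ∀ᵐ x ∂V.weight, extendZero F x = extendZero G x := by
  let b := Module.finBasis ℝ Y
  have key : ∀ (s : ℕ) (i : Fin (Module.finrank ℝ Y)), ∀ᵐ x ∂V.weight, ‖extendZero f x‖ < s + 1 →
      ∀ v, b.coord i (extendZero F x v) = b.coord i (extendZero G x v) := by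
    intro s i
    let α : Y →L[ℝ] ℝ := (b.coord i).toContinuousLinearMap
    let χ : ContDiffBump (0 : Y) := ⟨s + 1, s + 2, by positivity, by linarith⟩
    -- The cut-off makes the linear functional `α` admissible, and the product still has derivative
    -- `α` wherever `‖y‖ < s + 1`. Letting `s` and the coordinate vary recovers all of `F`.
    have hγ : ContDiff ℝ (⊤ : ℕ∞) (fun y => χ y * α y) := χ.contDiff.mul α.contDiff
    have hc : HasCompactSupport (fun y => χ y * α y) := χ.hasCompactSupport.mul_right
    filter_upwards [IsWeakDeriv.chainDeriv_ae_eq hf hF hG hγ (hc.fderiv ℝ)] with x hx hlt v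
    have hd : fderiv ℝ (fun y => χ y * α y) (extendZero f x) = α := by
      have : (fun y => χ y * α y) =ᶠ[𝓝 (extendZero f x)] α := by
        have hmem : extendZero f x ∈ Metric.ball (0 : Y) χ.rIn := by simpa using hlt
        filter_upwards [Metric.isOpen_ball.mem_nhds hmem] with y hy
        rw [χ.one_of_mem_closedBall (Metric.ball_subset_closedBall hy), one_mul]
      rw [this.fderiv_eq, ContinuousLinearMap.fderiv]
    have := congrArg (fun L : Euc n →L[ℝ] ℝ => L v) hx
    simp only [chainDeriv, hd] at this
    exact this
  filter_upwards [ae_all_iff.mpr fun s => ae_all_iff.mpr (key s)] with x hx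
  obtain ⟨s, hs⟩ := exists_nat_gt ‖extendZero f x‖
  ext v
  exact b.ext_elem fun i => hx s i (by linarith) v

theorem IsWeakDeriv.weakDeriv_ae_eq (hf : MeasurablePFun V.weight f)
    (hF : V.IsWeakDeriv f F) : ∀ᵐ x ∂V.weight, extendZero F x ∈ V.weakDeriv f x := by
  have hY := secondCountableTopology_target Y
  filter_upwards [ae_hasApproxLimit hF.measurable] with a ha
  have hex : ∃ σ, ∃ F, V.IsWeakDeriv f F ∧ HasApproxLimit V.weight F a σ := ⟨_, F, hF, ha⟩
  refine ⟨hex, ?_⟩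
  -- The value selected in `weakDeriv` may come from another representative `G`; almost uniqueness
  -- transfers its approximate limit to `F`.
  obtain ⟨G, hG, hGa⟩ := hex.choose_spec
  exact (hGa.congr_ae hG.measurable.ae_mem_dom hF.measurable.ae_mem_dom
    (hG.ae_eq hf hF)).unique ha

end Varifold

/-! ### A single piece of the partition. -/

namespace Varifold

variable {n m : ℕ} {U : Opens (Euc n)} {V W : Varifold m U} {E : Set U}
  {Y : Type*} [NormedAddCommGroup Y] [NormedSpace ℝ Y]
  {f : U →. Y} {F : U →. (Euc n →L[ℝ] Y)}

theorem GenWeaklyDiff.measurable_weight (hf : V.GenWeaklyDiff f) : MeasurablePFun V.weight f :=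
  hf.measurable.mono_ac (Measure.absolutelyContinuous_of_le (Measure.le_add_right le_rfl))

theorem firstVariation_eq_extendL1_indicator (hW : W = V.restrict E) (hb : V.distBoundary E = 0)
    (θ : 𝓓(U, Euc n)) :
    W.firstVariation θ = extendL1 V.firstVariation (E.indicator fun x => θ x) := by
  subst hW
  exact (sub_eq_zero.mp (congrFun hb θ)).symm

/-- This direction transfers null sets, hence measurability, from `W` back to `V` on `E`. -/
theorem restrict_add_le [IsFiniteMeasureOnCompacts V.normFirstVariation]
    (hE : MeasurableSet E) (hW : W = V.restrict E) (hb : V.distBoundary E = 0) :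
    (V.weight + V.normFirstVariation).restrict E ≤ W.weight + W.normFirstVariation := by
  have hV : IsFiniteMeasureOnCompacts (variation V.firstVariation) :=
    inferInstanceAs (IsFiniteMeasureOnCompacts V.normFirstVariation)
  rw [Measure.restrict_add, hW, weight_restrict V hE, ← hW]
  exact add_le_add le_rfl
    (restrict_le_variation hE (firstVariation_eq_extendL1_indicator hW hb))

variable [FiniteDimensional ℝ Y]

theorem GenWeaklyDiff.measurable_weakDeriv (hf : V.GenWeaklyDiff f) :
    MeasurablePFun V.weight (V.weakDeriv f) := by
  obtain ⟨G, hG⟩ := hf.exists_deriv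
  exact measurablePFun_of_ae_eq hG.measurable (hG.weakDeriv_ae_eq hf.measurable_weight)

theorem integrable_smul_testField {μ : Measure U} [IsFiniteMeasureOnCompacts μ]
    (hf : MeasurablePFun μ f) {γ : Y → ℝ} (hγ : ContDiff ℝ (⊤ : ℕ∞) γ)
    (hc : HasCompactSupport (fderiv ℝ γ)) (θ : 𝓓(U, Euc n)) :
    Integrable (fun x => γ (extendZero f x) • θ x) μ := by
  have hY := secondCountableTopology_target Y
  obtain ⟨C, hC⟩ := exists_forall_norm_le_of_hasCompactSupport_fderiv
    (hγ.differentiable (by simp)) hc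
  exact (integrable_comp_val μ θ).bdd_smul C
    (hγ.continuous.comp_aestronglyMeasurable hf.aestronglyMeasurable) (ae_of_all _ fun x => hC _)

/-- The integration by parts formula on one piece of a partition. -/
theorem extendL1_indicator_eq_setIntegral [IsFiniteMeasureOnCompacts V.normFirstVariation]
    (hE : MeasurableSet E) (hW : W = V.restrict E) (hb : V.distBoundary E = 0)
    {f' : U →. Y} (hf' : W.GenWeaklyDiff f') (hf : ∀ x ∈ E, f x = f' x)
    (hF : ∀ x ∈ E, F x = W.weakDeriv f' x) {γ : Y → ℝ} (hγ : ContDiff ℝ (⊤ : ℕ∞) γ)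
    (hc : HasCompactSupport (fderiv ℝ γ)) (θ : 𝓓(U, Euc n))
    (hint : Integrable (fun x => γ (extendZero f x) • θ x) V.normFirstVariation) :
    extendL1 V.firstVariation (E.indicator fun x => γ (extendZero f x) • θ x) =
      ∫ p in E ×ˢ univ, (γ (extendZero f p.1) * divIntegrand θ p +
        fderiv ℝ γ (extendZero f p.1) (extendZero F p.1 (θ p.1))) ∂V.meas := by
  have hV : IsFiniteMeasureOnCompacts (variation V.firstVariation) :=
    inferInstanceAs (IsFiniteMeasureOnCompacts V.normFirstVariation)
  have hext : ∀ x ∈ E, extendZero f x = extendZero f' x := by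
    intro x hx
    by_cases hd : x ∈ f'.Dom
    · exact extendZero_of_mem (by rw [hf x hx]; exact extendZero_mem hd)
    · have hd' : x ∉ f.Dom := by
        rw [PFun.mem_dom, hf x hx, ← PFun.mem_dom]
        exact hd
      rw [extendZero, extendZero, dif_neg hd, dif_neg hd']
  have hind : (E.indicator fun x => γ (extendZero f x) • θ x) =
      E.indicator fun x => γ (extendZero f' x) • θ x :=
    indicator_congr fun x hx => by rw [hext x hx]
  have hint' : Integrable (fun x => γ (extendZero f' x) • θ x)
      ((variation V.firstVariation).restrict E) := by
    refine (integrable_indicator_iff hE).mp ?_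
    rw [← hind]
    exact hint.indicator hE
  obtain ⟨G, hG⟩ := hf'.exists_deriv
  rw [hind, ← extendL1_eq_extendL1_indicator hE
    (firstVariation_eq_extendL1_indicator hW hb) hint', hG.integral_eq θ γ hγ hc]
  have hmeas : V.meas.restrict (E ×ˢ univ) = W.meas := by rw [hW]; rfl
  have hweight : ∀ᵐ x ∂W.weight, x ∈ E := by
    rw [hW, weight_restrict V hE]
    exact ae_restrict_mem hE
  rw [hmeas]
  refine integral_congr_ae ?_
  -- `W` is concentrated over `E`, where `F` is the weak derivative of `f'`, almost equal to the
  -- representative `G`.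
  filter_upwards [W.ae_comp_fst hweight,
    W.ae_comp_fst (hG.weakDeriv_ae_eq hf'.measurable_weight)] with p hp1 hp2
  rw [hext p.1 hp1, extendZero_of_mem (f := F) (hF p.1 hp1 ▸ hp2)]

end Varifold

end GMT

end

/-! ### Assembly of the pieces. -/

theorem mainTheorem7 {n m : ℕ} (hm : 0 < m) (hmn : m ≤ n) {U : Opens (Euc n)}
    (V : Varifold m U) (hV : IsFiniteMeasureOnCompacts V.normFirstVariation)
    {Y : Type*} [NormedAddCommGroup Y] [NormedSpace ℝ Y] [FiniteDimensional ℝ Y]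
    (Ξ : Set (Varifold m U)) (hΞ : Ξ.Countable)
    (ξ : Varifold m U → Set U) (hξ : ∀ W ∈ Ξ, MeasurableSet (ξ W))
    (hdisj : Ξ.PairwiseDisjoint ξ)
    (hcover : (V.weight + V.normFirstVariation) (⋃ W ∈ Ξ, ξ W)ᶜ = 0)
    (hrestrict : ∀ W ∈ Ξ, W = V.restrict (ξ W))
    (hbdry : ∀ W ∈ Ξ, V.distBoundary (ξ W) = 0)
    (fW : Varifold m U → (U →. Y)) (hfW : ∀ W ∈ Ξ, W.GenWeaklyDiff (fW W))
    (f : U →. Y) (hf : ∀ x y, y ∈ f x ↔ ∃ W ∈ Ξ, x ∈ ξ W ∧ y ∈ fW W x)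
    (F : U →. (Euc n →L[ℝ] Y))
    (hF : ∀ x σ, σ ∈ F x ↔ ∃ W ∈ Ξ, x ∈ ξ W ∧ σ ∈ W.weakDeriv (fW W) x) :
    MeasurablePFun (V.weight + V.normFirstVariation) f ∧
    MeasurablePFun V.weight F ∧
    (V.TruncSummable f F →
      V.GenWeaklyDiff f ∧
      ∀ᵐ x ∂V.weight, ∃ σ, σ ∈ V.weakDeriv f x ∧ σ ∈ F x) := by
  have hcov := Measure.add_apply V.weight V.normFirstVariation _ ▸ hcover
  rw [add_eq_zero] at hcov
  have hfm : MeasurablePFun (V.weight + V.normFirstVariation) f :=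
    measurablePFun_of_pieces hΞ hξ hcover (fun W hW => (hfW W hW).measurable.mono_ac
      (Measure.absolutelyContinuous_of_le
        (Varifold.restrict_add_le (hξ W hW) (hrestrict W hW) (hbdry W hW)))) hf
  have hFm : MeasurablePFun V.weight F :=
    measurablePFun_of_pieces hΞ hξ hcov.1 (fun W hW => by
      rw [← V.weight_restrict (hξ W hW), ← hrestrict W hW]
      exact (hfW W hW).measurable_weakDeriv) hF
  refine ⟨hfm, hFm, fun hsum => ?_⟩
  have hfV : MeasurablePFun V.weight f :=
    hfm.mono_ac (Measure.absolutelyContinuous_of_le (Measure.le_add_right le_rfl))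
  have hfδ : MeasurablePFun V.normFirstVariation f :=
    hfm.mono_ac (Measure.absolutelyContinuous_of_le (Measure.le_add_left le_rfl))
  have huniq : ∀ W ∈ Ξ, ∀ W' ∈ Ξ, ∀ x, x ∈ ξ W → x ∈ ξ W' → W' = W := fun W hW W' hW' x hx hx' =>
    hdisj.elim_set hW' hW x hx' hx
  have hfeq : ∀ W ∈ Ξ, ∀ x ∈ ξ W, f x = fW W x := fun W hW x hx => by
    refine Part.ext fun y => (hf x y).trans ⟨?_, fun hy => ⟨W, hW, hx, hy⟩⟩
    rintro ⟨W', hW', hx', hy⟩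
    rwa [huniq W hW W' hW' x hx hx'] at hy
  have hFeq : ∀ W ∈ Ξ, ∀ x ∈ ξ W, F x = W.weakDeriv (fW W) x := fun W hW x hx => by
    refine Part.ext fun y => (hF x y).trans ⟨?_, fun hy => ⟨W, hW, hx, hy⟩⟩
    rintro ⟨W', hW', hx', hy⟩
    rwa [huniq W hW W' hW' x hx hx'] at hy
  have hWD : V.IsWeakDeriv f F := by
    refine ⟨hFm, hsum, fun θ γ hγ hc => ?_⟩
    have hVT : IsFiniteMeasureOnCompacts (variation V.firstVariation) := hV
    have : Countable Ξ := hΞ.to_subtype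
    have hint := Varifold.integrable_smul_testField hfδ hγ hc θ
    have hd : Pairwise (Function.onFun Disjoint fun W : Ξ => ξ W) :=
      fun W W' hne => hdisj W.2 W'.2 fun h => hne (Subtype.ext h)
    have h1 := hasSum_extendL1_indicator V.firstVariation hint (A := fun W : Ξ => ξ W)
      (fun W => hξ W W.2) hd (by rw [iUnion_subtype]; exact hcov.2)
    -- Integrability over all of `V` is what `hsum` supplies; summability on each piece separately
    -- would not give it.
    have h2 := hasSum_integral_iUnion (μ := V.meas) (s := fun W : Ξ => ξ W ×ˢ (univ : Set (Grass n m)))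
      (fun W => (hξ W W.2).prod MeasurableSet.univ)
      (fun W W' hne => (hd hne).set_prod_left _ _)
      (Varifold.integrable_weakDeriv_integrand hfV hFm hsum hγ hc θ).integrableOn
    have hcovW : ∀ᵐ x ∂V.weight, x ∈ ⋃ W ∈ Ξ, ξ W := mem_ae_iff.mpr hcov.1
    have hcovM : ∀ᵐ p ∂V.meas, p ∈ ⋃ W : Ξ, ξ W ×ˢ (univ : Set (Grass n m)) := by
      filter_upwards [V.ae_comp_fst hcovW] with p hp
      obtain ⟨W, hW, hpW⟩ := mem_iUnion₂.mp hp
      exact mem_iUnion.mpr ⟨⟨W, hW⟩, hpW, mem_univ _⟩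
    rw [Measure.restrict_eq_self_of_ae_mem hcovM] at h2
    -- The two series agree term by term, hence so do their sums, which are the two sides of the
    -- identity for `V`.
    refine h1.unique (h2.congr_fun ?_)
    intro W
    exact Varifold.extendL1_indicator_eq_setIntegral (hξ W W.2) (hrestrict W W.2) (hbdry W W.2)
      (hfW W W.2) (hfeq W W.2) (hFeq W W.2) hγ hc θ hint
  refine ⟨⟨hfm, F, hWD⟩, ?_⟩
  filter_upwards [hWD.weakDeriv_ae_eq hfV, hFm.ae_mem_dom] with x hx hd
  exact ⟨_, hx, extendZero_mem hd⟩
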